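/- **Setting.** Let $F:\mathbb{R}^d\to\mathbb{R}$ be differentiable and bounded below, $F^{\inf}:=\inf F$, let $\mathcal{D}$ be a probability distribution and let $\nabla f(x,\xi)$ be a (jointly measurable) stochastic gradient oracle. Let $1<p\le 2$, $1\le q\le 2$, $\sigma_1>0$, $\bar L>0$, and assume that for all $x,y\in\mathbb{R}^d$ - ($p$-BCM) $\mathbb{E}_{\xi\sim\mathcal{D}}[\nabla f(x,\xi)]=\nabla F(x)$ and $\mathbb{E}_{\xi\sim\mathcal{D}}\|\nabla f(x,\xi)-\nabla F(x)\|^p\le\sigma_1^p$; - ($q$-weak average smoothness) $\mathbb{E}_{\xi\sim\mathcal{D}}\|\nabla f(x,\xi)-\nabla f(y,\xi)\|^q\le\bar L^q\|x-y\|^q$. Let $\mathrm{clip}(v,\lambda)=\min\{1,\lambda/\|v\|\}\,v$ for $v\ne0$ and $\mathrm{clip}(0,\lambda)=0$. With the convention $0/\|0\|=0$, *Double-Clipped NSGD-MVR* with starting point $x_0$, initial vector $g_0$ and parameters $T,\alpha,\lambda_1,\lambda_2,\gamma$ sets $x_1=x_0-\gamma g_0/\|g_0\|$ and, for $t=1,\dots,T-1$,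 with i.i.d. samples $\xi_t\sim\mathcal{D}$, $$g_t=(1-\alpha)\bigl(g_{t-1}+\mathrm{clip}(\nabla f(x_t,\xi_t)-\nabla f(x_{t-1},\xi_t),\lambda_1)\bigr)+\alpha\,\mathrm{clip}(\nabla f(x_t,\xi_t),\lambda_2),\qquad x_{t+1}=x_t-\gamma\frac{g_t}{\|g_t\|}.$$ **Theorem.** There is an absolute constant $c>0$, and for every $\kappa\in(0,c]$ there is a constant $C>0$ depending only on $\kappa$, such that the following holds in every setting as above. Let $T\ge1$ be an integer, $\beta\in(0,1]$, let $x_0\in\mathbb{R}^d$ satisfy $\Delta:=F(x_0)-F^{\inf}>0$, and run Double-Clipped NSGD-MVR with $g_0=0$, $$\alpha=\max\bigl\{T^{-\frac{p}{2p-1}},\,T^{-\frac{pq}{p(2q+1)-2q}}\bigr\},\quad \lambda_1=2\gamma\bar L\alpha^{-1/q},\quad \lambda_2=\max\bigl\{4\sqrt{\bar L\Delta},\,\sigma_1\alpha^{-1/p}\bigr\},$$ and any stepsize $\gamma$ with $\kappa M\le\gamma\le cM$, where $$M=\min\left\{\sqrt{\frac{\Delta}{\bar LT}},\ \alpha\sqrt{\frac{\Delta}{\bar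 L}},\ \frac{1}{\alpha T\log\frac{8T}{\beta}}\sqrt{\frac{\Delta}{\bar L}},\ \frac{\Delta}{\sigma_1\alpha^{\frac{p-1}{p}}T\log\frac{8T}{\beta}},\ \sqrt{\frac{\Delta\,\alpha^{1/q}}{\bar LT\log\frac{8T}{\beta}}}\right\}.$$ Then, with probability at least $1-\beta$, $$\frac1T\sum_{t=0}^{T-1}\|\nabla F(x_t)\|\le\frac{2\Delta}{\gamma T} \qquad\text{and}\qquad \frac1T\sum_{t=0}^{T-1}\|\nabla F(x_t)\|\le C\,\frac{\sqrt{\bar L\Delta}+\sigma_1}{T^{\min\left\{\frac{p-1}{2p-1},\ \frac{q(p-1)}{p(2q+1)-2q}\right\}}}\,\log\frac{8T}{\beta},$$ and, if $T\ge2$, the second bound also holds with $\log\frac{T}{\beta}$ in place of $\log\frac{8T}{\beta}$. -/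

import Mathlib

open MeasureTheory ProbabilityTheory

namespace DClipMVR

/-- The space `ℝ^d` with its Euclidean norm. -/
abbrev Vec (d : ℕ) : Type := EuclideanSpace ℝ (Fin d)

/-- The initial suboptimality `Δ = F(x₀) - inf F`. -/
noncomputable def subopt {d : ℕ} (F : Vec d → ℝ) (x₀ : Vec d) : ℝ :=
  F x₀ - ⨅ x, F x

/-- `∇f(x, ξ)` is an unbiased estimator of `∇F(x)` whose `p`-th central moment is bounded
by `σ₁ ^ p`, uniformly in `x` (`ξ` has law `D`). -/
structure BoundedCentralMoment {d : ℕ} {Ξ : Type*} [MeasurableSpace Ξ] (D : Measure Ξ)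
    (F : Vec d → ℝ) (gradf : Vec d → Ξ → Vec d) (p σ₁ : ℝ) : Prop where
  integrable_grad : ∀ x, Integrable (fun s => gradf x s) D
  unbiased : ∀ x, ∫ s, gradf x s ∂D = gradient F x
  integrable_moment : ∀ x, Integrable (fun s => ‖gradf x s - gradient F x‖ ^ p) D
  moment_le : ∀ x, ∫ s, ‖gradf x s - gradient F x‖ ^ p ∂D ≤ σ₁ ^ p

/-- `q`-weak average smoothness with constant `L`:
`E ‖∇f(x, ξ) - ∇f(y, ξ)‖ ^ q ≤ L ^ q ‖x - y‖ ^ q` for all `x`, `y`. -/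
structure WeakAverageSmooth {d : ℕ} {Ξ : Type*} [MeasurableSpace Ξ] (D : Measure Ξ)
    (gradf : Vec d → Ξ → Vec d) (q L : ℝ) : Prop where
  integrable_diff : ∀ x y, Integrable (fun s => ‖gradf x s - gradf y s‖ ^ q) D
  diff_le : ∀ x y, ∫ s, ‖gradf x s - gradf y s‖ ^ q ∂D ≤ L ^ q * ‖x - y‖ ^ q

/-- The clipping operator `clip(v, lam) = min {1, lam / ‖v‖} v` (which is `0` at `v = 0`). -/
noncomputable def clip {d : ℕ} (v : Vec d) (lam : ℝ) : Vec d :=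
  min 1 (lam / ‖v‖) • v

/-- The normalized step `x - γ g / ‖g‖`, with the convention `0 / ‖0‖ = 0`. -/
noncomputable def descend {d : ℕ} (γ : ℝ) (x g : Vec d) : Vec d :=
  x - γ • (‖g‖⁻¹ • g)

/-- The state of the algorithm after the estimate `g_t` has been formed and the step has been
made: `x = x_t`, `next = x_{t+1}`, `g = g_t`. -/
structure State (d : ℕ) where
  x : Vec d
  next : Vec d
  g : Vec d

/-- The update of the gradient estimate:
`(1 - α) (g + clip(∇f(y, s) - ∇f(x, s), lam₁)) + α clip(∇f(y, s), lam₂)`. -/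
noncomputable def updateEstimate {d : ℕ} {Ξ : Type*} (gradf : Vec d → Ξ → Vec d)
    (α lam₁ lam₂ : ℝ) (g x y : Vec d) (s : Ξ) : Vec d :=
  (1 - α) • (g + clip (gradf y s - gradf x s) lam₁) + α • clip (gradf y s) lam₂

/-- Double-Clipped NSGD-MVR, run on the sequence of samples `s`, where the sample `s t` is used
to form `g_t` for `t ≥ 1`. -/
noncomputable def run {d : ℕ} {Ξ : Type*} (gradf : Vec d → Ξ → Vec d) (α lam₁ lam₂ γ : ℝ)
    (x₀ g₀ : Vec d) (s : ℕ → Ξ) : ℕ → State d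
  | 0 => ⟨x₀, descend γ x₀ g₀, g₀⟩
  | t + 1 =>
    let S := run gradf α lam₁ lam₂ γ x₀ g₀ s t
    let g' := updateEstimate gradf α lam₁ lam₂ S.g S.x S.next (s (t + 1))
    ⟨S.next, descend γ S.next g', g'⟩

/-- The iterate `x_t`. -/
noncomputable def iter {d : ℕ} {Ξ : Type*} (gradf : Vec d → Ξ → Vec d) (α lam₁ lam₂ γ : ℝ)
    (x₀ g₀ : Vec d) (s : ℕ → Ξ) (t : ℕ) : Vec d :=
  (run gradf α lam₁ lam₂ γ x₀ g₀ s t).x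

/-- The gradient estimate `g_t`. -/
noncomputable def estimate {d : ℕ} {Ξ : Type*} (gradf : Vec d → Ξ → Vec d) (α lam₁ lam₂ γ : ℝ)
    (x₀ g₀ : Vec d) (s : ℕ → Ξ) (t : ℕ) : Vec d :=
  (run gradf α lam₁ lam₂ γ x₀ g₀ s t).g

theorem iter_succ {d : ℕ} {Ξ : Type*} (gradf : Vec d → Ξ → Vec d) (α lam₁ lam₂ γ : ℝ)
    (x₀ g₀ : Vec d) (s : ℕ → Ξ) (t : ℕ) :
    iter gradf α lam₁ lam₂ γ x₀ g₀ s (t + 1) =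
      iter gradf α lam₁ lam₂ γ x₀ g₀ s t -
        γ • (‖estimate gradf α lam₁ lam₂ γ x₀ g₀ s t‖⁻¹ •
          estimate gradf α lam₁ lam₂ γ x₀ g₀ s t) := by
  cases t <;> rfl

theorem estimate_succ {d : ℕ} {Ξ : Type*} (gradf : Vec d → Ξ → Vec d) (α lam₁ lam₂ γ : ℝ)
    (x₀ g₀ : Vec d) (s : ℕ → Ξ) (t : ℕ) :
    estimate gradf α lam₁ lam₂ γ x₀ g₀ s (t + 1) =
      (1 - α) • (estimate gradf α lam₁ lam₂ γ x₀ g₀ s t +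
        clip (gradf (iter gradf α lam₁ lam₂ γ x₀ g₀ s (t + 1)) (s (t + 1)) -
          gradf (iter gradf α lam₁ lam₂ γ x₀ g₀ s t) (s (t + 1))) lam₁) +
        α • clip (gradf (iter gradf α lam₁ lam₂ γ x₀ g₀ s (t + 1)) (s (t + 1))) lam₂ := rfl

/-- The average gradient norm `(1 / T) ∑_{t < T} ‖∇F(x_t)‖` along the run. -/
noncomputable def avgGradNorm {d : ℕ} {Ξ : Type*} (F : Vec d → ℝ) (gradf : Vec d → Ξ → Vec d)
    (α lam₁ lam₂ γ : ℝ) (x₀ g₀ : Vec d) (s : ℕ → Ξ) (T : ℕ) : ℝ :=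
  (1 / (T : ℝ)) *
    ∑ t ∈ Finset.range T, ‖gradient F (iter gradf α lam₁ lam₂ γ x₀ g₀ s t)‖

/-- `α = max {T ^ (-p / (2p - 1)), T ^ (-pq / (p(2q + 1) - 2q))}`. -/
noncomputable def momentum (p q : ℝ) (T : ℕ) : ℝ :=
  max ((T : ℝ) ^ (-(p / (2 * p - 1)))) ((T : ℝ) ^ (-(p * q / (p * (2 * q + 1) - 2 * q))))

/-- `lam₁ = 2 γ L α ^ (-1 / q)`. -/
noncomputable def threshold₁ (q L α γ : ℝ) : ℝ :=
  2 * γ * L * α ^ (-(1 / q))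

/-- `lam₂ = max {4 √(L Δ), σ₁ α ^ (-1 / p)}`. -/
noncomputable def threshold₂ (p L σ₁ Δ α : ℝ) : ℝ :=
  max (4 * √(L * Δ)) (σ₁ * α ^ (-(1 / p)))

/-- The minimum of five terms to which the stepsize is proportional; `l` is the
logarithmic factor. -/
noncomputable def stepScale (p q L σ₁ Δ α : ℝ) (T : ℕ) (l : ℝ) : ℝ :=
  min (√(Δ / (L * T)))
    (min (α * √(Δ / L))
      (min (1 / (α * T * l) * √(Δ / L))
        (min (Δ / (σ₁ * α ^ ((p - 1) / p) * T * l))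
          (√(Δ * α ^ (1 / q) / (L * T * l))))))

/-- `(√(L Δ) + σ₁) / T ^ min {(p - 1) / (2p - 1), q(p - 1) / (p(2q + 1) - 2q)}`. -/
noncomputable def rate (p q L σ₁ Δ : ℝ) (T : ℕ) : ℝ :=
  (√(L * Δ) + σ₁) /
    (T : ℝ) ^ (min ((p - 1) / (2 * p - 1)) (q * (p - 1) / (p * (2 * q + 1) - 2 * q)))

end DClipMVR

/-! Write e_t = g_t - ∇F(x_t). A normalized step decreases F by γ‖∇F(x_t)‖, up to a loss of 2γ‖e_t‖
+ Lγ²/2 (`descend_le`), so everything rests on the sum of the ‖e_t‖. Each update multiplies e_t by 1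
- α and adds a bias and a centered noise. The thresholds are chosen so that the q-th moment of the
gradient difference is at most α lam₁^q and the central p-th moment of the gradient at most α
lam₂^p. Truncation at such a level lam has bias of order α lam and second moment of order α lam²
(`WeakAverageSmooth.clip_diff_le`, `BoundedCentralMoment.clip_grad_le`). The geometric weights
cancel one factor α, so the accumulated bias is at most lam₁ + 2α lam₂.

The noise is controlled by a Lyapunov function. Divided by 6(lam₁ + α lam₂), its accumulation M_t
contracts by 1 - α and receives centered increments of size at most 1/3 and second moment at most
α/4. The bound E exp √(1 + ‖M_t‖²) ≤ e² is stable under this recursion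
(`lintegral_exp_softNorm_le`), and Markov's inequality with a union bound over T times gives ‖M_t‖ <
2 + log(T/β), free of the dimension.

There is a circularity: clipping at lam₂ is harmless only where ‖∇F‖ ≤ lam₂/2. The noise is
therefore set to zero elsewhere, which makes the probabilistic bound unconditional. On the good
event, `sum_norm_gradient_le` shows inductively that the suboptimality stays below 2Δ, which forces
‖∇F(x_t)‖ ≤ 2√(LΔ) ≤ lam₂/2. Finally `budget_le` checks that γ ≤ M/100 keeps the total loss below Δ,
and `le_stepScale_mul_rate` turns γ ≥ κM into the rate. -/

namespace DClipMVR

/-! ### Descent estimates for smooth functions. -/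

section Smooth

variable {d : ℕ} {F : Vec d → ℝ} {L : ℝ}

/-- The quadratic upper bound for a function with `L`-Lipschitz gradient. -/
theorem le_add_inner_gradient_add_sq (hF : Differentiable ℝ F)
    (hL : ∀ x y, ‖gradient F x - gradient F y‖ ≤ L * ‖x - y‖) (x v : Vec d) :
    F (x + v) ≤ F x + inner ℝ (gradient F x) v + L / 2 * ‖v‖ ^ 2 := by
  have hline : ∀ t : ℝ, HasDerivAt (fun t : ℝ => F (x + t • v) -
      (t * inner ℝ (gradient F x) v + L / 2 * ‖v‖ ^ 2 * t ^ 2))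
      (inner ℝ (gradient F (x + t • v)) v -
        (1 * inner ℝ (gradient F x) v + L / 2 * ‖v‖ ^ 2 * (2 * t))) t := by
    intro t
    have h1 : HasDerivAt (fun t : ℝ => x + t • v) v t := by
      simpa using ((hasDerivAt_id t).smul_const v).const_add x
    have h2 := (hF (x + t • v)).hasGradientAt.hasFDerivAt.comp_hasDerivAt t h1
    have h3 : HasDerivAt (fun t : ℝ => t ^ 2) (2 * t) t := by
      simpa using hasDerivAt_pow 2 t
    have h2' : HasDerivAt (fun t : ℝ => F (x + t • v))
        (inner ℝ (gradient F (x + t • v)) v) t := by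
      simpa [Function.comp_def] using h2
    exact h2'.sub (((hasDerivAt_id t).mul_const _).add (h3.const_mul _))
  have hanti := antitoneOn_of_deriv_nonpos (convex_Icc (0 : ℝ) 1)
    (fun t _ => (hline t).continuousAt.continuousWithinAt)
    (fun t _ => (hline t).differentiableAt.differentiableWithinAt) (by
      intro t ht
      rw [interior_Icc] at ht
      rw [(hline t).deriv]
      have h1 : inner ℝ (gradient F (x + t • v) - gradient F x) v ≤ L * (t * ‖v‖) * ‖v‖ := by
        refine (real_inner_le_norm _ _).trans ?_
        gcongr
        refine (hL _ _).trans_eq ?_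
        rw [add_sub_cancel_left, norm_smul, Real.norm_of_nonneg ht.1.le]
      rw [inner_sub_left] at h1
      linarith)
  have := hanti (Set.left_mem_Icc.2 zero_le_one) (Set.right_mem_Icc.2 zero_le_one) zero_le_one
  simp only [one_smul, zero_smul, add_zero] at this
  linarith

/-- The squared gradient norm is controlled by the suboptimality. -/
theorem norm_gradient_sq_le (hF : Differentiable ℝ F) (hb : BddBelow (Set.range F)) (hL0 : 0 < L)
    (hL : ∀ x y, ‖gradient F x - gradient F y‖ ≤ L * ‖x - y‖) (x : Vec d) :
    ‖gradient F x‖ ^ 2 ≤ 2 * L * subopt F x := by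
  -- This step minimizes the quadratic upper bound.
  have h1 := le_add_inner_gradient_add_sq hF hL x (-(L⁻¹ • gradient F x))
  have h2 : ⨅ x, F x ≤ F (x + -(L⁻¹ • gradient F x)) := ciInf_le hb _
  rw [inner_neg_right, inner_smul_right, real_inner_self_eq_norm_sq, norm_neg, norm_smul,
    Real.norm_of_nonneg (inv_pos.2 hL0).le] at h1
  have h3 : L * (L⁻¹ * ‖gradient F x‖ ^ 2) = ‖gradient F x‖ ^ 2 := by field_simp
  have h4 : L / 2 * (L⁻¹ * ‖gradient F x‖) ^ 2 = L⁻¹ * ‖gradient F x‖ ^ 2 / 2 := by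
    field_simp
  rw [h4] at h1
  unfold subopt
  nlinarith

theorem norm_inv_smul_self_le {d : ℕ} (g : Vec d) : ‖‖g‖⁻¹ • g‖ ≤ 1 := by
  rw [norm_smul, norm_inv, norm_norm]
  exact inv_mul_le_one

/-- One-step progress of a normalized step along an inexact gradient. -/
theorem descend_le (hF : Differentiable ℝ F) (hL0 : 0 < L)
    (hL : ∀ x y, ‖gradient F x - gradient F y‖ ≤ L * ‖x - y‖) {γ : ℝ} (hγ : 0 ≤ γ)
    (x g : Vec d) :
    F (descend γ x g) ≤ F x - γ * ‖gradient F x‖ + 2 * γ * ‖g - gradient F x‖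
      + L / 2 * γ ^ 2 := by
  have h1 := le_add_inner_gradient_add_sq hF hL x (-(γ • (‖g‖⁻¹ • g)))
  have hu := norm_inv_smul_self_le g
  rw [inner_neg_right, inner_smul_right, norm_neg, norm_smul, Real.norm_of_nonneg hγ] at h1
  have h2 : inner ℝ g (‖g‖⁻¹ • g) = ‖g‖ := by
    rw [inner_smul_right, real_inner_self_eq_norm_sq]
    rcases eq_or_ne ‖g‖ 0 with h | h
    · simp [h]
    · field_simp
  have h3 : inner ℝ (g - gradient F x) (‖g‖⁻¹ • g) ≤ ‖g - gradient F x‖ :=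
    (real_inner_le_norm _ _).trans (mul_le_of_le_one_right (norm_nonneg _) hu)
  rw [inner_sub_left, h2] at h3
  have h4 : ‖gradient F x‖ ≤ ‖g‖ + ‖g - gradient F x‖ := by
    have := norm_sub_le g (g - gradient F x)
    simpa using this
  have h5 : (γ * ‖‖g‖⁻¹ • g‖) ^ 2 ≤ γ ^ 2 := by
    rw [mul_pow]
    exact mul_le_of_le_one_right (sq_nonneg _) (pow_le_one₀ (norm_nonneg _) hu)
  -- The error enters twice: in replacing ∇F by g inside the inner product, and in replacing ‖g‖ by
  -- ‖∇F‖. The case g = 0 is included, since the error is then ‖∇F‖ itself.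
  have h6 : γ * (‖gradient F x‖ - 2 * ‖g - gradient F x‖)
      ≤ γ * inner ℝ (gradient F x) (‖g‖⁻¹ • g) := by
    gcongr
    linarith
  have h7 : L / 2 * (γ * ‖‖g‖⁻¹ • g‖) ^ 2 ≤ L / 2 * γ ^ 2 := by gcongr
  have h8 : descend γ x g = x + -(γ • (‖g‖⁻¹ • g)) := sub_eq_add_neg _ _
  rw [h8]
  linarith

theorem norm_descend_sub_le {γ : ℝ} (hγ : 0 ≤ γ) (x g : Vec d) : ‖descend γ x g - x‖ ≤ γ := by
  unfold descend
  rw [sub_sub_cancel_left, norm_neg, norm_smul, Real.norm_of_nonneg hγ]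
  exact mul_le_of_le_one_right hγ (norm_inv_smul_self_le g)

end Smooth

/-! ### Scalar moment inequalities. -/

section Power

/-- Jensen's inequality in the form needed here: a bound on the `q`-th moment bounds the mean. -/
theorem integral_le_of_integral_rpow_le {Ξ : Type*} [MeasurableSpace Ξ] {D : Measure Ξ}
    [IsProbabilityMeasure D] {h : Ξ → ℝ} {q τ : ℝ} (hq : 1 ≤ q) (hτ : 0 < τ) (h0 : ∀ s, 0 ≤ h s)
    (hi : Integrable (fun s => h s ^ q) D) (hle : ∫ s, h s ^ q ∂D ≤ τ ^ q) :
    ∫ s, h s ∂D ≤ τ := by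
  have hq0 : 0 < q := by linarith
  -- The tangent line of u ↦ u^q at u = 1, where u = h/τ (Bernoulli). Only h^q then has to be
  -- integrable.
  have key : ∀ s, h s ≤ τ * (1 - 1 / q) + τ / q / τ ^ q * h s ^ q := by
    intro s
    have h1 := one_add_mul_self_le_rpow_one_add (s := h s / τ - 1)
      (by have := div_nonneg (h0 s) hτ.le; linarith) hq
    rw [add_sub_cancel, Real.div_rpow (h0 s) hτ.le] at h1
    have h2 : h s = τ / q * (1 + q * (h s / τ - 1)) + τ * (1 - 1 / q) := by
      field_simp
      ring
    calc h s = τ / q * (1 + q * (h s / τ - 1)) + τ * (1 - 1 / q) := h2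
      _ ≤ τ / q * (h s ^ q / τ ^ q) + τ * (1 - 1 / q) := by gcongr
      _ = _ := by ring
  have hi2 : Integrable (fun s => τ * (1 - 1 / q) + τ / q / τ ^ q * h s ^ q) D :=
    (integrable_const _).add (hi.const_mul _)
  calc ∫ s, h s ∂D ≤ ∫ s, τ * (1 - 1 / q) + τ / q / τ ^ q * h s ^ q ∂D :=
        integral_mono_of_nonneg (.of_forall h0) hi2 (.of_forall key)
    _ = τ * (1 - 1 / q) + τ / q / τ ^ q * ∫ s, h s ^ q ∂D := by
        rw [integral_add (integrable_const _) (hi.const_mul _), integral_const,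
          integral_const_mul, probReal_univ, one_smul]
    _ ≤ τ * (1 - 1 / q) + τ / q / τ ^ q * τ ^ q := by gcongr
    _ = τ := by
        have : τ ^ q ≠ 0 := (Real.rpow_pos_of_pos hτ q).ne'
        field_simp
        ring

/-- The excess is positive only where u = h/lam exceeds 1, and there u ≤ u^r. -/
theorem sub_le_mul_div_rpow {h lam r : ℝ} (h0 : 0 ≤ h) (hlam : 0 < lam) (hr : 1 ≤ r) :
    max (h - lam) 0 ≤ lam * (h / lam) ^ r := by
  have hu : 0 ≤ h / lam := by positivity
  refine max_le ?_ (by positivity)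
  rcases le_total (h / lam) 1 with h1 | h1
  · have : h ≤ lam := by rwa [div_le_one hlam] at h1
    have : 0 ≤ lam * (h / lam) ^ r := by positivity
    linarith
  · have h2 : h / lam ≤ (h / lam) ^ r := Real.self_le_rpow_of_one_le h1 hr
    have h3 : lam * (h / lam) = h := by field_simp
    nlinarith

/-- Below the truncation level the ratio a/lam is at most 1, so its square is at most its r-th power
for r ≤ 2. -/
theorem sq_le_mul_div_rpow {a h lam r : ℝ} (ha : 0 ≤ a) (hlam : 0 < lam)
    (hah : a ≤ h) (hal : a ≤ lam) (hr0 : 1 ≤ r) (hr : r ≤ 2) :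
    a ^ 2 ≤ lam ^ 2 * (h / lam) ^ r := by
  have h1 : (a / lam) ^ 2 ≤ (a / lam) ^ r := by
    rw [← Real.rpow_natCast]
    have hal' : a / lam ≤ 1 := (div_le_one hlam).2 hal
    rcases ha.eq_or_lt with rfl | ha'
    · simp [Real.zero_rpow (by linarith : r ≠ 0)]
    · exact Real.rpow_le_rpow_of_exponent_ge (by positivity) hal' (by exact_mod_cast hr)
  have h2 : (a / lam) ^ r ≤ (h / lam) ^ r := by gcongr
  calc a ^ 2 = lam ^ 2 * (a / lam) ^ 2 := by field_simp
    _ ≤ _ := by gcongr; exact h1.trans h2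

end Power

/-! ### The clipping operator. -/

section Clip

variable {d : ℕ}

theorem norm_clip (v : Vec d) {lam : ℝ} (hlam : 0 ≤ lam) : ‖clip v lam‖ = min ‖v‖ lam := by
  unfold clip
  rw [norm_smul, Real.norm_of_nonneg (le_min zero_le_one (by positivity))]
  rcases (norm_nonneg v).eq_or_lt with h | h
  · rw [← h]; simp [hlam]
  · rw [min_mul_of_nonneg _ _ h.le, one_mul, div_mul_cancel₀ _ h.ne']

theorem norm_clip_sub_le (v : Vec d) (lam : ℝ) :
    ‖clip v lam - v‖ ≤ max (‖v‖ - lam) 0 := by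
  have h1 : clip v lam - v = -((1 - min 1 (lam / ‖v‖)) • v) := by
    unfold clip
    rw [sub_smul, one_smul, neg_sub]
  rw [h1, norm_neg, norm_smul, Real.norm_of_nonneg (sub_nonneg.2 (min_le_left _ _))]
  rcases (norm_nonneg v).eq_or_lt with h | h
  · rw [← h]; simp
  · rcases le_total 1 (lam / ‖v‖) with h2 | h2
    · rw [min_eq_left h2]; simp
    · rw [min_eq_right h2, sub_mul, one_mul, div_mul_cancel₀ _ h.ne']
      exact le_max_left _ _

theorem measurable_clip (lam : ℝ) : Measurable fun v : Vec d => clip v lam := by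
  unfold clip
  exact (measurable_const.min (measurable_const.div measurable_norm)).smul measurable_id

end Clip

/-! ### Bias and second moment of truncated vectors. -/

section Moments

variable {d : ℕ} {Ξ : Type*} [MeasurableSpace Ξ] {D : Measure Ξ}

theorem integral_mul_div_rpow_le {h : Ξ → ℝ} {lam r a c : ℝ} (h0 : ∀ s, 0 ≤ h s)
    (hlam : 0 < lam) (hc : 0 ≤ c) (hle : ∫ s, h s ^ r ∂D ≤ a * lam ^ r) :
    ∫ s, c * (h s / lam) ^ r ∂D ≤ a * c := by
  have h1 : (fun s => c * (h s / lam) ^ r) = fun s => c / lam ^ r * h s ^ r := by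
    funext s
    rw [Real.div_rpow (h0 s) hlam.le]
    ring
  have hp : 0 < lam ^ r := Real.rpow_pos_of_pos hlam r
  rw [h1, integral_const_mul]
  calc c / lam ^ r * ∫ s, h s ^ r ∂D ≤ c / lam ^ r * (a * lam ^ r) := by gcongr
    _ = a * c := by field_simp

theorem integrable_mul_div_rpow {h : Ξ → ℝ} {lam r c : ℝ} (h0 : ∀ s, 0 ≤ h s)
    (hlam : 0 < lam) (hi : Integrable (fun s => h s ^ r) D) :
    Integrable (fun s => c * (h s / lam) ^ r) D := by
  have h1 : (fun s => c * (h s / lam) ^ r) = fun s => c / lam ^ r * h s ^ r := by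
    funext s
    rw [Real.div_rpow (h0 s) hlam.le]
    ring
  rw [h1]
  exact hi.const_mul _

/-- The bias of a truncation is controlled by an `r`-th moment. -/
theorem norm_integral_sub_le {w v : Ξ → Vec d} {h : Ξ → ℝ} {lam r a : ℝ} (h0 : ∀ s, 0 ≤ h s)
    (hlam : 0 < lam) (hr : 1 ≤ r) (hi : Integrable (fun s => h s ^ r) D)
    (hle : ∫ s, h s ^ r ∂D ≤ a * lam ^ r) (hw : Integrable w D) (hv : Integrable v D)
    (hwv : ∀ s, ‖w s - v s‖ ≤ max (h s - lam) 0) :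
    ‖∫ s, w s ∂D - ∫ s, v s ∂D‖ ≤ a * lam := by
  rw [← integral_sub hw hv]
  calc ‖∫ s, w s - v s ∂D‖ ≤ ∫ s, lam * (h s / lam) ^ r ∂D :=
        norm_integral_le_of_norm_le (integrable_mul_div_rpow h0 hlam hi)
          (.of_forall fun s => (hwv s).trans (sub_le_mul_div_rpow (h0 s) hlam hr))
    _ ≤ a * lam := integral_mul_div_rpow_le h0 hlam hlam.le hle

/-- The second moment of a truncation is controlled by an `r`-th moment with `r ≤ 2`. -/
theorem integral_norm_sq_le {w : Ξ → Vec d} {h : Ξ → ℝ} {lam r a : ℝ} (h0 : ∀ s, 0 ≤ h s)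
    (hlam : 0 < lam) (hr : 1 ≤ r) (hr2 : r ≤ 2) (hi : Integrable (fun s => h s ^ r) D)
    (hle : ∫ s, h s ^ r ∂D ≤ a * lam ^ r) (hwh : ∀ s, ‖w s‖ ≤ h s) (hwl : ∀ s, ‖w s‖ ≤ lam) :
    ∫ s, ‖w s‖ ^ 2 ∂D ≤ a * lam ^ 2 :=
  (integral_mono_of_nonneg (.of_forall fun _ => sq_nonneg _) (integrable_mul_div_rpow h0 hlam hi)
    (.of_forall fun s => sq_le_mul_div_rpow (norm_nonneg _) hlam (hwh s) (hwl s) hr hr2)).trans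
    (integral_mul_div_rpow_le h0 hlam (sq_nonneg _) hle)

variable [IsProbabilityMeasure D]

theorem integrable_of_norm_le {w : Ξ → Vec d} (hw : Measurable w) {c : ℝ} (hc : ∀ s, ‖w s‖ ≤ c) :
    Integrable w D :=
  .of_bound hw.aestronglyMeasurable c (.of_forall hc)

theorem integrable_norm_sq_of_norm_le {w : Ξ → Vec d} (hw : Measurable w) {c : ℝ}
    (hc : ∀ s, ‖w s‖ ≤ c) : Integrable (fun s => ‖w s‖ ^ 2) D :=
  .of_bound (hw.norm.pow_const 2).aestronglyMeasurable (c ^ 2) (.of_forall fun s => by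
    rw [Real.norm_of_nonneg (sq_nonneg _)]
    have := hc s
    gcongr)

theorem norm_sub_integral_le {w : Ξ → Vec d} {c : ℝ} (hc : ∀ s, ‖w s‖ ≤ c) (s : Ξ) :
    ‖w s - ∫ s, w s ∂D‖ ≤ 2 * c := by
  have h1 : ‖∫ s, w s ∂D‖ ≤ c := by
    simpa using norm_integral_le_of_norm_le_const (μ := D) (.of_forall hc)
  linarith [norm_sub_le (w s) (∫ s, w s ∂D), hc s]

/-- The mean minimizes the mean square distance. -/
theorem integral_norm_sub_integral_sq_le {w : Ξ → Vec d} (hw : Measurable w) {c : ℝ}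
    (hc : ∀ s, ‖w s‖ ≤ c) (z : Vec d) :
    ∫ s, ‖w s - ∫ s, w s ∂D‖ ^ 2 ∂D ≤ ∫ s, ‖w s - z‖ ^ 2 ∂D := by
  set m := ∫ s, w s ∂D with hm
  have hwi : Integrable w D := integrable_of_norm_le hw hc
  have h1 : ∀ s, ‖w s - z‖ ^ 2 =
      ‖w s - m‖ ^ 2 + (2 * inner ℝ (m - z) (w s - m) + ‖m - z‖ ^ 2) := by
    intro s
    have : w s - z = (w s - m) + (m - z) := by abel
    rw [this, norm_add_sq_real, real_inner_comm]
    ring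
  have h2 : Integrable (fun s => ‖w s - m‖ ^ 2) D :=
    integrable_norm_sq_of_norm_le (hw.sub_const m) (norm_sub_integral_le hc)
  have h3 : Integrable (fun s => w s - m) D := hwi.sub (integrable_const _)
  have h4 : Integrable (fun s => 2 * inner ℝ (m - z) (w s - m)) D :=
    (h3.const_inner (m - z)).const_mul 2
  have h5 : ∫ s, w s - m ∂D = 0 := by
    rw [integral_sub hwi (integrable_const _), integral_const, probReal_univ, one_smul, sub_self]
  have h6 : ∫ s, ‖w s - z‖ ^ 2 ∂D = ∫ s, ‖w s - m‖ ^ 2 ∂D + ‖m - z‖ ^ 2 := by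
    have h7 : Integrable (fun s => 2 * inner ℝ (m - z) (w s - m) + ‖m - z‖ ^ 2) D :=
      h4.add (integrable_const _)
    simp_rw [h1]
    rw [integral_add h2 h7, integral_add h4 (integrable_const _),
      integral_const_mul, integral_inner h3, h5, inner_zero_right, integral_const,
      probReal_univ, one_smul, mul_zero, zero_add]
  rw [h6]
  exact le_add_of_nonneg_right (sq_nonneg _)

end Moments

/-! ### One update of the gradient estimate: bias and noise. -/

section Oracle

variable {d : ℕ} {Ξ : Type*} [MeasurableSpace Ξ] {D : Measure Ξ}
  {F : Vec d → ℝ} {gradf : Vec d → Ξ → Vec d} {p q L σ₁ : ℝ}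

/-- Smoothness of F is not assumed: by unbiasedness the gradient difference is a mean of oracle
differences, whose q-th moment bounds it. -/
theorem BoundedCentralMoment.lipschitz_gradient [IsProbabilityMeasure D]
    (hB : BoundedCentralMoment D F gradf p σ₁)
    (hW : WeakAverageSmooth D gradf q L) (hq : 1 ≤ q) (hL : 0 < L) (x y : Vec d) :
    ‖gradient F x - gradient F y‖ ≤ L * ‖x - y‖ := by
  rcases eq_or_ne x y with rfl | hxy
  · simp
  have hpos : 0 < ‖x - y‖ := norm_pos_iff.2 (sub_ne_zero.2 hxy)
  rw [← hB.unbiased, ← hB.unbiased, ← integral_sub (hB.integrable_grad x) (hB.integrable_grad y)]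
  refine (norm_integral_le_integral_norm _).trans
    (integral_le_of_integral_rpow_le hq (mul_pos hL hpos) (fun _ => norm_nonneg _)
      (hW.integrable_diff x y) ?_)
  rw [Real.mul_rpow hL.le hpos.le]
  exact hW.diff_le x y

theorem WeakAverageSmooth.integral_diff_rpow_le (hW : WeakAverageSmooth D gradf q L)
    (hq : 1 ≤ q) (hL : 0 < L) {γ a : ℝ} (ha : (L * γ) ^ q ≤ a) {x y : Vec d}
    (hxy : ‖y - x‖ ≤ γ) : ∫ s, ‖gradf y s - gradf x s‖ ^ q ∂D ≤ a := by
  refine (hW.diff_le y x).trans (le_trans ?_ ha)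
  have hγ : 0 ≤ γ := (norm_nonneg _).trans hxy
  rw [Real.mul_rpow hL.le hγ]
  gcongr

/-- The centered increment of the gradient estimate, cut off at pairs of points where it is not
under control. -/
noncomputable def noise (D : Measure Ξ) (F : Vec d → ℝ) (gradf : Vec d → Ξ → Vec d)
    (α lam₁ lam₂ γ : ℝ) (x y : Vec d) (s : Ξ) : Vec d :=
  open Classical in
  -- With this cutoff the variance bound holds at every pair of points, so no stopping time is
  -- needed. Along a run on the good event the condition is always met.
  if ‖y - x‖ ≤ γ ∧ ‖gradient F y‖ ≤ lam₂ / 2 then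
    (1 - α) • (clip (gradf y s - gradf x s) lam₁ - ∫ s, clip (gradf y s - gradf x s) lam₁ ∂D) +
      α • (clip (gradf y s) lam₂ - ∫ s, clip (gradf y s) lam₂ ∂D)
  else 0

variable {α lam₁ lam₂ γ : ℝ} [IsProbabilityMeasure D]

theorem norm_noise_le (hα0 : 0 ≤ α) (hα1 : α ≤ 1) (h₁ : 0 ≤ lam₁) (h₂ : 0 ≤ lam₂) (x y : Vec d)
    (s : Ξ) : ‖noise D F gradf α lam₁ lam₂ γ x y s‖ ≤ 2 * (lam₁ + α * lam₂) := by
  unfold noise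
  split_ifs with h
  · refine (norm_add_le _ _).trans ?_
    rw [norm_smul, norm_smul, Real.norm_of_nonneg (sub_nonneg.2 hα1), Real.norm_of_nonneg hα0]
    have ha := norm_sub_integral_le (D := D) (w := fun s => clip (gradf y s - gradf x s) lam₁)
      (fun s => (norm_clip _ h₁).trans_le (min_le_right _ _)) s
    have hb := norm_sub_integral_le (D := D) (w := fun s => clip (gradf y s) lam₂)
      (fun s => (norm_clip _ h₂).trans_le (min_le_right _ _)) s
    have h3 := mul_le_mul_of_nonneg_left hb hα0
    have h4 := mul_le_of_le_one_left (norm_nonneg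
      (clip (gradf y s - gradf x s) lam₁ - ∫ s, clip (gradf y s - gradf x s) lam₁ ∂D))
      (sub_le_self 1 hα0)
    linarith
  · rw [norm_zero]
    positivity

theorem measurable_clip_diff (hm : Measurable (Function.uncurry gradf)) (lam : ℝ) :
    Measurable fun w : (Vec d × Vec d) × Ξ => clip (gradf w.1.2 w.2 - gradf w.1.1 w.2) lam :=
  (measurable_clip lam).comp
    ((hm.comp (measurable_fst.snd.prodMk measurable_snd)).sub
      (hm.comp (measurable_fst.fst.prodMk measurable_snd)))

theorem measurable_clip_grad (hm : Measurable (Function.uncurry gradf)) (lam : ℝ) :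
    Measurable fun w : (Vec d × Vec d) × Ξ => clip (gradf w.1.2 w.2) lam :=
  (measurable_clip lam).comp (hm.comp (measurable_fst.snd.prodMk measurable_snd))

theorem measurable_noise (hm : Measurable (Function.uncurry gradf))
    (hg : Measurable (gradient F)) :
    Measurable fun w : (Vec d × Vec d) × Ξ =>
      noise D F gradf α lam₁ lam₂ γ w.1.1 w.1.2 w.2 := by
  unfold noise
  have hA := measurable_clip_diff hm lam₁
  have hB := measurable_clip_grad hm lam₂
  have hA' : Measurable fun w : (Vec d × Vec d) × Ξ =>
      ∫ s, clip (gradf w.1.2 s - gradf w.1.1 s) lam₁ ∂D :=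
    (hA.stronglyMeasurable.integral_prod_right' (ν := D)).measurable.comp measurable_fst
  have hB' : Measurable fun w : (Vec d × Vec d) × Ξ => ∫ s, clip (gradf w.1.2 s) lam₂ ∂D :=
    (hB.stronglyMeasurable.integral_prod_right' (ν := D)).measurable.comp measurable_fst
  refine Measurable.ite ?_ (((hA.sub hA').const_smul (1 - α)).add
    ((hB.sub hB').const_smul α)) measurable_const
  have hxy : MeasurableSet {w : (Vec d × Vec d) × Ξ | ‖w.1.2 - w.1.1‖ ≤ γ} :=
    measurableSet_le (measurable_fst.snd.sub measurable_fst.fst).norm measurable_const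
  have hy : MeasurableSet {w : (Vec d × Vec d) × Ξ | ‖gradient F w.1.2‖ ≤ lam₂ / 2} :=
    measurableSet_le (hg.comp measurable_fst.snd).norm measurable_const
  exact hxy.inter hy

theorem measurable_clip_diff_right (hm : Measurable (Function.uncurry gradf)) (lam : ℝ)
    (x y : Vec d) : Measurable fun s => clip (gradf y s - gradf x s) lam :=
  (measurable_clip lam).comp
    ((hm.comp measurable_prodMk_left).sub (hm.comp measurable_prodMk_left))

theorem measurable_clip_grad_right (hm : Measurable (Function.uncurry gradf)) (lam : ℝ)
    (y : Vec d) : Measurable fun s => clip (gradf y s) lam :=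
  (measurable_clip lam).comp (hm.comp measurable_prodMk_left)

theorem integral_noise (hm : Measurable (Function.uncurry gradf)) (h₁ : 0 ≤ lam₁) (h₂ : 0 ≤ lam₂)
    (x y : Vec d) : ∫ s, noise D F gradf α lam₁ lam₂ γ x y s ∂D = 0 := by
  unfold noise
  split_ifs with h
  · have hA : Integrable (fun s => clip (gradf y s - gradf x s) lam₁) D :=
      integrable_of_norm_le (measurable_clip_diff_right hm lam₁ x y)
        fun s => (norm_clip _ h₁).trans_le (min_le_right _ _)
    have hB : Integrable (fun s => clip (gradf y s) lam₂) D :=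
      integrable_of_norm_le (measurable_clip_grad_right hm lam₂ y)
        fun s => (norm_clip _ h₂).trans_le (min_le_right _ _)
    have hA' : Integrable (fun s => (1 - α) • (clip (gradf y s - gradf x s) lam₁ -
        ∫ s, clip (gradf y s - gradf x s) lam₁ ∂D)) D := (hA.sub (integrable_const _)).smul (1 - α)
    have hB' : Integrable (fun s => α • (clip (gradf y s) lam₂ -
        ∫ s, clip (gradf y s) lam₂ ∂D)) D := (hB.sub (integrable_const _)).smul α
    rw [integral_add hA' hB', integral_smul, integral_smul, integral_sub hA (integrable_const _),
      integral_sub hB (integrable_const _)]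
    simp
  · simp

/-- Bounds for the clipped gradient difference at points at distance at most `γ`. -/
theorem WeakAverageSmooth.clip_diff_le (hW : WeakAverageSmooth D gradf q L)
    (hB : BoundedCentralMoment D F gradf p σ₁)
    (hm : Measurable (Function.uncurry gradf)) (hq : 1 ≤ q) (hq2 : q ≤ 2) (hL : 0 < L)
    (h₁ : 0 < lam₁) (hlam : (L * γ) ^ q ≤ α * lam₁ ^ q) {x y : Vec d} (hxy : ‖y - x‖ ≤ γ) :
    ‖∫ s, clip (gradf y s - gradf x s) lam₁ ∂D - (gradient F y - gradient F x)‖ ≤ α * lam₁ ∧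
    ∫ s, ‖clip (gradf y s - gradf x s) lam₁‖ ^ 2 ∂D ≤ α * lam₁ ^ 2 := by
  have hle := hW.integral_diff_rpow_le hq hL hlam hxy
  have hbd : ∀ s, ‖clip (gradf y s - gradf x s) lam₁‖ = min _ lam₁ := fun s => norm_clip _ h₁.le
  constructor
  · rw [← hB.unbiased, ← hB.unbiased,
      ← integral_sub (hB.integrable_grad y) (hB.integrable_grad x)]
    exact norm_integral_sub_le (fun _ => norm_nonneg _) h₁ hq (hW.integrable_diff y x) hle
      (integrable_of_norm_le (measurable_clip_diff_right hm lam₁ x y)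
        fun s => (hbd s).trans_le (min_le_right _ _))
      ((hB.integrable_grad y).sub (hB.integrable_grad x)) fun s => norm_clip_sub_le _ _
  · exact integral_norm_sq_le (fun _ => norm_nonneg _) h₁ hq hq2 (hW.integrable_diff y x) hle
      (fun s => (hbd s).trans_le (min_le_left _ _)) fun s => (hbd s).trans_le (min_le_right _ _)

/-- Bounds for the clipped gradient at points where the true gradient is at most `lam₂ / 2`. -/
theorem BoundedCentralMoment.clip_grad_le (hB : BoundedCentralMoment D F gradf p σ₁)
    (hm : Measurable (Function.uncurry gradf)) (hp : 1 ≤ p) (hp2 : p ≤ 2) (hα : 0 ≤ α)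
    (h₂ : 0 < lam₂) (hlam : σ₁ ^ p ≤ α * lam₂ ^ p) {y : Vec d}
    (hy : ‖gradient F y‖ ≤ lam₂ / 2) :
    ‖∫ s, clip (gradf y s) lam₂ ∂D - gradient F y‖ ≤ 2 * (α * lam₂) ∧
    ∫ s, ‖clip (gradf y s) lam₂ - gradient F y‖ ^ 2 ∂D ≤ 4 * (α * lam₂ ^ 2) := by
  have hle : ∫ s, ‖gradf y s - gradient F y‖ ^ p ∂D ≤ α * lam₂ ^ p := (hB.moment_le y).trans hlam
  have hbd : ∀ s, ‖clip (gradf y s) lam₂‖ ≤ lam₂ :=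
    fun s => (norm_clip _ h₂.le).trans_le (min_le_right _ _)
  have htri : ∀ s, ‖gradf y s‖ ≤ ‖gradf y s - gradient F y‖ + lam₂ / 2 := fun s => by
    have := norm_add_le (gradf y s - gradient F y) (gradient F y)
    rw [sub_add_cancel] at this
    linarith
  -- Since the true gradient takes up at most half of the threshold, the clipped part is bounded by
  -- the excess of the central deviation over lam₂/2. Halving the level costs 2^p ≤ 4 in the moment
  -- bound.
  have hcl : ∀ s, ‖clip (gradf y s) lam₂ - gradf y s‖ ≤
      max (‖gradf y s - gradient F y‖ - lam₂ / 2) 0 := fun s =>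
    (norm_clip_sub_le _ _).trans (max_le_max_right 0 (by linarith [htri s]))
  have h2p : (2 : ℝ) ^ p ≤ 4 := by
    calc (2 : ℝ) ^ p ≤ 2 ^ (2 : ℝ) := Real.rpow_le_rpow_of_exponent_le one_le_two hp2
      _ = 4 := by norm_num
  constructor
  · have h3 : ∫ s, ‖gradf y s - gradient F y‖ ^ p ∂D ≤ 4 * α * (lam₂ / 2) ^ p := by
      refine hle.trans ?_
      have : lam₂ ^ p = 2 ^ p * (lam₂ / 2) ^ p := by
        rw [← Real.mul_rpow (by norm_num) (by positivity)]
        congr 1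
        ring
      rw [this]
      have h4 : 0 ≤ (lam₂ / 2) ^ p := by positivity
      calc α * (2 ^ p * (lam₂ / 2) ^ p) ≤ α * (4 * (lam₂ / 2) ^ p) := by gcongr
        _ = _ := by ring
    have := norm_integral_sub_le (fun _ => norm_nonneg _) (half_pos h₂) hp
      (hB.integrable_moment y) h3 (integrable_of_norm_le (measurable_clip_grad_right hm lam₂ y) hbd)
      (hB.integrable_grad y) hcl
    rw [hB.unbiased] at this
    linarith
  -- The clipped gradient deviates from ∇F(y) by at most twice the raw deviation and by at most 3/2
  -- lam₂. Doubling both the deviation and the level keeps the factor α, and (2 lam₂)² gives the 4.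
  · have h5 : ∫ s, (2 * ‖gradf y s - gradient F y‖) ^ p ∂D ≤ α * (2 * lam₂) ^ p := by
      simp_rw [Real.mul_rpow zero_le_two (norm_nonneg _)]
      rw [integral_const_mul, Real.mul_rpow zero_le_two h₂.le]
      have : 0 ≤ (2 : ℝ) ^ p := by positivity
      nlinarith
    have h6 := integral_norm_sq_le (D := D) (w := fun s => clip (gradf y s) lam₂ - gradient F y)
      (h := fun s => 2 * ‖gradf y s - gradient F y‖) (lam := 2 * lam₂)
      (fun _ => by positivity) (by positivity) hp hp2
      (by
        simp_rw [Real.mul_rpow zero_le_two (norm_nonneg _)]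
        exact (hB.integrable_moment y).const_mul _) h5
      (fun s => by
        have h7 : clip (gradf y s) lam₂ - gradient F y =
          (clip (gradf y s) lam₂ - gradf y s) + (gradf y s - gradient F y) := by abel
        have h8 : max (‖gradf y s - gradient F y‖ - lam₂ / 2) 0 ≤ ‖gradf y s - gradient F y‖ :=
          max_le (by linarith) (norm_nonneg _)
        rw [h7]
        refine (norm_add_le _ _).trans ?_
        linarith [hcl s])
      (fun s => (norm_sub_le _ _).trans (by linarith [hbd s]))
    linarith

theorem integral_norm_noise_sq_le (hB : BoundedCentralMoment D F gradf p σ₁)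
    (hW : WeakAverageSmooth D gradf q L) (hm : Measurable (Function.uncurry gradf))
    (hp : 1 ≤ p) (hp2 : p ≤ 2) (hq : 1 ≤ q) (hq2 : q ≤ 2) (hL : 0 < L)
    (hα0 : 0 ≤ α) (hα1 : α ≤ 1) (h₁ : 0 < lam₁) (h₂ : 0 < lam₂)
    (hlam₁ : (L * γ) ^ q ≤ α * lam₁ ^ q) (hlam₂ : σ₁ ^ p ≤ α * lam₂ ^ p) (x y : Vec d) :
    ∫ s, ‖noise D F gradf α lam₁ lam₂ γ x y s‖ ^ 2 ∂D ≤ 8 * α * (lam₁ + α * lam₂) ^ 2 := by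
  unfold noise
  split_ifs with h
  · set a := fun s => clip (gradf y s - gradf x s) lam₁
    set b := fun s => clip (gradf y s) lam₂
    have ham : Measurable a := measurable_clip_diff_right hm lam₁ x y
    have hbm : Measurable b := measurable_clip_grad_right hm lam₂ y
    have hab : ∀ s, ‖a s‖ ≤ lam₁ := fun s => (norm_clip _ h₁.le).trans_le (min_le_right _ _)
    have hbb : ∀ s, ‖b s‖ ≤ lam₂ := fun s => (norm_clip _ h₂.le).trans_le (min_le_right _ _)
    -- Variances are at most the second moments about any point; the points 0 and ∇F(y) are those at
    -- which the truncation bounds are available.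
    have hA := integral_norm_sub_integral_sq_le (D := D) ham hab 0
    have hBb := integral_norm_sub_integral_sq_le (D := D) hbm hbb (gradient F y)
    simp only [sub_zero] at hA
    have hA' := hA.trans (hW.clip_diff_le hB hm hq hq2 hL h₁ hlam₁ h.1).2
    have hB' := hBb.trans (hB.clip_grad_le hm hp hp2 hα0 h₂ hlam₂ h.2).2
    have iA : Integrable (fun s => ‖a s - ∫ s, a s ∂D‖ ^ 2) D :=
      integrable_norm_sq_of_norm_le (ham.sub_const _) (norm_sub_integral_le hab)
    have iB : Integrable (fun s => ‖b s - ∫ s, b s ∂D‖ ^ 2) D :=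
      integrable_norm_sq_of_norm_le (hbm.sub_const _) (norm_sub_integral_le hbb)
    calc ∫ s, ‖(1 - α) • (a s - ∫ s, a s ∂D) + α • (b s - ∫ s, b s ∂D)‖ ^ 2 ∂D
        ≤ ∫ s, 2 * ‖a s - ∫ s, a s ∂D‖ ^ 2 + 2 * α ^ 2 * ‖b s - ∫ s, b s ∂D‖ ^ 2 ∂D := by
          refine integral_mono_of_nonneg (.of_forall fun _ => sq_nonneg _)
            ((iA.const_mul _).add (iB.const_mul _)) (.of_forall fun s => ?_)
          have h1 := norm_add_le ((1 - α) • (a s - ∫ s, a s ∂D)) (α • (b s - ∫ s, b s ∂D))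
          rw [norm_smul, norm_smul, Real.norm_of_nonneg (sub_nonneg.2 hα1),
            Real.norm_of_nonneg hα0] at h1
          have h2 := mul_le_of_le_one_left (norm_nonneg (a s - ∫ s, a s ∂D)) (sub_le_self 1 hα0)
          have h3 := pow_le_pow_left₀ (norm_nonneg _) (h1.trans (add_le_add_left h2 _)) 2
          have h4 := add_sq_le (a := ‖a s - ∫ s, a s ∂D‖) (b := α * ‖b s - ∫ s, b s ∂D‖)
          simp only
          nlinarith
      _ ≤ 2 * (α * lam₁ ^ 2) + 2 * α ^ 2 * (4 * (α * lam₂ ^ 2)) := by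
          rw [integral_add (iA.const_mul _) (iB.const_mul _), integral_const_mul,
            integral_const_mul]
          gcongr
      _ ≤ 8 * α * (lam₁ + α * lam₂) ^ 2 := by
          have : 0 ≤ α * (6 * lam₁ ^ 2 + 16 * (lam₁ * (α * lam₂))) := by positivity
          linarith
  · simp only [norm_zero, ne_eq, OfNat.ofNat_ne_zero, not_false_eq_true, zero_pow,
      integral_zero]
    positivity

/-- The error of the gradient estimate is contracted, up to noise and a small bias. -/
theorem norm_updateEstimate_sub_le (hB : BoundedCentralMoment D F gradf p σ₁)
    (hW : WeakAverageSmooth D gradf q L) (hm : Measurable (Function.uncurry gradf))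
    (hp : 1 ≤ p) (hp2 : p ≤ 2) (hq : 1 ≤ q) (hq2 : q ≤ 2) (hL : 0 < L)
    (hα0 : 0 ≤ α) (hα1 : α ≤ 1) (h₁ : 0 < lam₁) (h₂ : 0 < lam₂)
    (hlam₁ : (L * γ) ^ q ≤ α * lam₁ ^ q) (hlam₂ : σ₁ ^ p ≤ α * lam₂ ^ p) {x y : Vec d}
    (hxy : ‖y - x‖ ≤ γ) (hy : ‖gradient F y‖ ≤ lam₂ / 2) (g m : Vec d) (s : Ξ) :
    ‖updateEstimate gradf α lam₁ lam₂ g x y s - gradient F y -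
        ((1 - α) • m + noise D F gradf α lam₁ lam₂ γ x y s)‖ ≤
      (1 - α) * ‖g - gradient F x - m‖ + α * (lam₁ + 2 * α * lam₂) := by
  have hA := (hW.clip_diff_le hB hm hq hq2 hL h₁ hlam₁ hxy).1
  have hBb := (hB.clip_grad_le hm hp hp2 hα0 h₂ hlam₂ hy).1
  unfold noise updateEstimate
  rw [if_pos ⟨hxy, hy⟩]
  set a := ∫ s, clip (gradf y s - gradf x s) lam₁ ∂D
  set b := ∫ s, clip (gradf y s) lam₂ ∂D
  have hdec : (1 - α) • (g + clip (gradf y s - gradf x s) lam₁) + α • clip (gradf y s) lam₂ -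
      gradient F y - ((1 - α) • m + ((1 - α) • (clip (gradf y s - gradf x s) lam₁ - a) +
        α • (clip (gradf y s) lam₂ - b))) =
      (1 - α) • (g - gradient F x - m) + ((1 - α) • (a - (gradient F y - gradient F x)) +
        α • (b - gradient F y)) := by
    module
  rw [hdec]
  refine (norm_add_le _ _).trans (add_le_add ?_ ((norm_add_le _ _).trans ?_))
  · rw [norm_smul, Real.norm_of_nonneg (sub_nonneg.2 hα1)]
  · rw [norm_smul, norm_smul, Real.norm_of_nonneg (sub_nonneg.2 hα1), Real.norm_of_nonneg hα0]
    have h3 := mul_le_mul_of_nonneg_left hBb hα0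
    have h4 := mul_le_of_le_one_left (norm_nonneg (a - (gradient F y - gradient F x)))
      (sub_le_self 1 hα0)
    linarith

end Oracle

/-! ### A Lyapunov function for noisy contractions. -/

section SoftNorm

variable {d : ℕ}

/-- A smooth substitute for the norm. -/
noncomputable def softNorm (y : Vec d) : ℝ := √(1 + ‖y‖ ^ 2)

theorem one_le_softNorm (y : Vec d) : 1 ≤ softNorm y :=
  Real.one_le_sqrt.2 (le_add_of_nonneg_right (sq_nonneg _))

theorem norm_le_softNorm (y : Vec d) : ‖y‖ ≤ softNorm y :=
  Real.le_sqrt_of_sq_le (by linarith)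

theorem softNorm_sq (y : Vec d) : softNorm y ^ 2 = 1 + ‖y‖ ^ 2 :=
  Real.sq_sqrt (by positivity)

theorem measurable_softNorm : Measurable (softNorm (d := d)) :=
  (measurable_const.add (measurable_norm.pow_const 2)).sqrt

/-- This is convexity between y and 0, where the soft norm equals 1. -/
theorem softNorm_smul_le {a : ℝ} (ha0 : 0 ≤ a) (ha1 : a ≤ 1) (y : Vec d) :
    softNorm ((1 - a) • y) ≤ (1 - a) * softNorm y + a := by
  have h1 := one_le_softNorm y
  have h2 := softNorm_sq y
  have h0 : 0 ≤ (1 - a) * softNorm y + a := by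
    have := mul_nonneg (sub_nonneg.2 ha1) (zero_le_one.trans h1)
    linarith
  refine Real.sqrt_le_iff.2 ⟨h0, ?_⟩
  rw [norm_smul, Real.norm_of_nonneg (sub_nonneg.2 ha1)]
  have h3 : 0 ≤ a * (1 - a) * (softNorm y - 1) :=
    mul_nonneg (mul_nonneg ha0 (sub_nonneg.2 ha1)) (sub_nonneg.2 h1)
  rw [mul_pow, eq_sub_of_add_eq' h2.symm]
  linarith

/-- The inequality 2ab ≤ a² + b² for the two soft norms, divided by 2 `softNorm y`. The quadratic
remainder is uniform in y because the soft norm is at least 1; the norm itself has no such expansion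
near 0. -/
theorem softNorm_add_le (y e : Vec d) :
    softNorm (y + e) ≤ softNorm y + (inner ℝ y e / softNorm y + ‖e‖ ^ 2 / 2) := by
  have h1 := one_le_softNorm y
  have h0 : 0 < softNorm y := by linarith
  have h2 := softNorm_sq y
  have h3 := softNorm_sq (y + e)
  rw [norm_add_sq_real] at h3
  have h4 : softNorm (y + e) * (2 * softNorm y) ≤ softNorm (y + e) ^ 2 + softNorm y ^ 2 := by
    nlinarith [sq_nonneg (softNorm (y + e) - softNorm y)]
  have h5 : softNorm (y + e) ≤
      (2 * softNorm y ^ 2 + 2 * inner ℝ y e + ‖e‖ ^ 2) / (2 * softNorm y) := by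
    rw [le_div_iff₀ (by positivity)]
    linarith
  refine h5.trans ?_
  have h6 : (2 * softNorm y ^ 2 + 2 * inner ℝ y e + ‖e‖ ^ 2) / (2 * softNorm y) =
      softNorm y + (inner ℝ y e / softNorm y + ‖e‖ ^ 2 / 2 / softNorm y) := by
    field_simp
    ring
  have h7 : ‖e‖ ^ 2 / 2 / softNorm y ≤ ‖e‖ ^ 2 / 2 := div_le_self (by positivity) h1
  linarith

/-- The increment u of the soft norm satisfies |u| ≤ 7/6 ‖e‖ ≤ 1, so exp u ≤ 1 + u + u². The
quadratic terms add up to (1/2 + 49/36)‖e‖² ≤ 2‖e‖². The linear term will vanish in the mean. -/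
theorem exp_softNorm_add_le (y : Vec d) {e : Vec d} (he : ‖e‖ ≤ 1 / 3) :
    Real.exp (softNorm (y + e)) ≤
      Real.exp (softNorm y) * (1 + (softNorm y)⁻¹ * inner ℝ y e + 2 * ‖e‖ ^ 2) := by
  have h0 : 0 < softNorm y := zero_lt_one.trans_le (one_le_softNorm y)
  set u := inner ℝ y e / softNorm y + ‖e‖ ^ 2 / 2 with hu
  have h1 : |inner ℝ y e / softNorm y| ≤ ‖e‖ := by
    rw [abs_div, abs_of_pos h0, div_le_iff₀ h0, mul_comm]
    exact (abs_real_inner_le_norm y e).trans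
      (mul_le_mul_of_nonneg_right (norm_le_softNorm y) (norm_nonneg _))
  have hn := norm_nonneg e
  have h2 : |u| ≤ 7 / 6 * ‖e‖ := by
    refine (abs_add_le _ _).trans ?_
    rw [abs_of_nonneg (a := ‖e‖ ^ 2 / 2) (by positivity)]
    nlinarith
  have h3 : |u| ≤ 1 := by linarith
  have h4 := (abs_le.1 (Real.abs_exp_sub_one_sub_id_le h3)).2
  have h5 : u ^ 2 ≤ 49 / 36 * ‖e‖ ^ 2 := by
    rw [← sq_abs]
    have := pow_le_pow_left₀ (abs_nonneg u) h2 2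
    nlinarith
  calc Real.exp (softNorm (y + e)) ≤ Real.exp (softNorm y + u) :=
        Real.exp_le_exp.2 (softNorm_add_le y e)
    _ = Real.exp (softNorm y) * Real.exp u := Real.exp_add _ _
    _ ≤ _ := by
      have h6 : (softNorm y)⁻¹ * inner ℝ y e = inner ℝ y e / softNorm y := by
        rw [div_eq_inv_mul]
      rw [h6]
      gcongr
      nlinarith [sq_nonneg ‖e‖]

/-- One step of the contraction of the exponential moment of a noisy contraction. -/
theorem lintegral_exp_softNorm_le {Ξ : Type*} [MeasurableSpace Ξ] {D : Measure Ξ}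
    [IsProbabilityMeasure D] {e : Ξ → Vec d} (hm : Measurable e) (he : ∀ s, ‖e s‖ ≤ 1 / 3)
    (h0 : ∫ s, e s ∂D = 0) {a : ℝ} (ha0 : 0 ≤ a) (ha1 : a ≤ 1)
    (h2 : ∫ s, ‖e s‖ ^ 2 ∂D ≤ a / 4) (m : Vec d) :
    ∫⁻ s, ENNReal.ofReal (Real.exp (softNorm ((1 - a) • m + e s))) ∂D ≤
      ENNReal.ofReal ((1 - a) * Real.exp (softNorm m) + a * Real.exp 2) := by
  set y := (1 - a) • m with hy
  have i1 : Integrable e D := integrable_of_norm_le hm he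
  have i2 : Integrable (fun s => ‖e s‖ ^ 2) D := integrable_norm_sq_of_norm_le hm he
  have i3 : Integrable (fun s => (softNorm y)⁻¹ * inner ℝ y (e s)) D :=
    (i1.const_inner y).const_mul _
  have i4 : Integrable (fun s => 1 + (softNorm y)⁻¹ * inner ℝ y (e s)) D :=
    (integrable_const _).add i3
  have i5 : Integrable (fun s => 1 + (softNorm y)⁻¹ * inner ℝ y (e s) + 2 * ‖e s‖ ^ 2) D :=
    i4.add (i2.const_mul 2)
  have hle : ∀ s, Real.exp (softNorm (y + e s)) ≤
      Real.exp (softNorm y) * (1 + (softNorm y)⁻¹ * inner ℝ y (e s) + 2 * ‖e s‖ ^ 2) :=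
    fun s => exp_softNorm_add_le y (he s)
  calc ∫⁻ s, ENNReal.ofReal (Real.exp (softNorm (y + e s))) ∂D
      ≤ ∫⁻ s, ENNReal.ofReal (Real.exp (softNorm y) *
          (1 + (softNorm y)⁻¹ * inner ℝ y (e s) + 2 * ‖e s‖ ^ 2)) ∂D :=
        lintegral_mono fun s => ENNReal.ofReal_le_ofReal (hle s)
    _ = ENNReal.ofReal (∫ s, Real.exp (softNorm y) *
          (1 + (softNorm y)⁻¹ * inner ℝ y (e s) + 2 * ‖e s‖ ^ 2) ∂D) :=
        (ofReal_integral_eq_lintegral_ofReal (i5.const_mul _)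
          (.of_forall fun s => (Real.exp_pos _).le.trans (hle s))).symm
    _ ≤ _ := by
      refine ENNReal.ofReal_le_ofReal ?_
      rw [integral_const_mul, integral_add i4 (i2.const_mul 2), integral_add (integrable_const _) i3,
        integral_const_mul, integral_inner i1, h0, inner_zero_right, integral_const,
        probReal_univ, one_smul, integral_const_mul, mul_zero, add_zero]
      have h3 := softNorm_smul_le ha0 ha1 m
      calc Real.exp (softNorm y) * (1 + 2 * ∫ s, ‖e s‖ ^ 2 ∂D)
          ≤ Real.exp (softNorm y) * Real.exp a := by
            gcongr
            linarith [Real.add_one_le_exp a]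
        _ = Real.exp (softNorm y + a) := (Real.exp_add _ _).symm
        -- One a comes from the contraction of the soft norm and one from the noise; convexity of
        -- exp then makes e² a fixed point of the moment recursion.
        _ ≤ Real.exp ((1 - a) * softNorm m + a * 2) := Real.exp_le_exp.2 (by linarith)
        _ ≤ _ := by
          have := convexOn_exp.2 (Set.mem_univ (softNorm m)) (Set.mem_univ (2 : ℝ))
            (sub_nonneg.2 ha1) ha0 (sub_add_cancel 1 a)
          simpa using this

end SoftNorm

/-! ### Exponential moments of recursions driven by independent samples. -/

section Chain

variable {Ξ Ω X : Type*} [MeasurableSpace Ξ] [MeasurableSpace Ω] [MeasurableSpace X]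
  {P : Measure Ω} {ξ : ℕ → Ω → Ξ}

/-- A recursion driven by independent samples is independent of the next sample. -/
theorem measurable_and_indepFun_of_recursion (hξ : ∀ t, Measurable (ξ t)) (hind : iIndepFun ξ P)
    {step : X → Ξ → X} (hs : Measurable (Function.uncurry step)) {Y : ℕ → Ω → X} (y₀ : X)
    (h0 : ∀ ω, Y 0 ω = y₀) (hY : ∀ t ω, Y (t + 1) ω = step (Y t ω) (ξ (t + 1) ω)) (t : ℕ) :
    Measurable (Y t) ∧ IndepFun (Y t) (ξ (t + 1)) P := by
  -- The state at time t depends only on the samples of index at most t, an index set disjoint from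
  -- {t + 1}.
  have hmeas : ∀ t, Measurable[⨆ i ∈ Set.Iic t, MeasurableSpace.comap (ξ i) inferInstance] (Y t) := by
    intro t
    induction t with
    | zero =>
      have : Y 0 = fun _ => y₀ := funext h0
      rw [this]
      exact measurable_const
    | succ t ih =>
      have : Y (t + 1) = fun ω => Function.uncurry step (Y t ω, ξ (t + 1) ω) := funext (hY t)
      rw [this]
      refine hs.comp (Measurable.prodMk ?_ ?_)
      · exact ih.mono (biSup_mono fun i (hi : i ≤ t) => Nat.le_succ_of_le hi) le_rfl
      · exact (comap_measurable (ξ (t + 1))).mono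
          (le_biSup (fun i => MeasurableSpace.comap (ξ i) inferInstance)
            (Set.mem_Iic.2 le_rfl)) le_rfl
  refine ⟨(hmeas t).mono (iSup₂_le fun i _ => (hξ i).comap_le) le_rfl, ?_⟩
  have h1 := indep_iSup_of_disjoint (fun i => (hξ i).comap_le) hind
    (S := Set.Iic t) (T := {t + 1}) (by simp)
  rw [IndepFun_iff_Indep]
  refine indep_of_indep_of_le_left (indep_of_indep_of_le_right h1 ?_) (hmeas t).comap_le
  simp

/-- Tonelli on the product law: the past is frozen while the new sample is averaged. This stands in
for conditional expectation. -/
theorem lintegral_comp_of_indepFun [IsProbabilityMeasure P] {Y : Ω → X} {ζ : Ω → Ξ} (hY : Measurable Y)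
    (hζ : Measurable ζ) (hind : IndepFun Y ζ P) {G : X × Ξ → ENNReal} (hG : Measurable G) :
    ∫⁻ ω, G (Y ω, ζ ω) ∂P = ∫⁻ ω, ∫⁻ s, G (Y ω, s) ∂(P.map ζ) ∂P := by
  have h1 := (indepFun_iff_map_prod_eq_prod_map_map hY.aemeasurable hζ.aemeasurable).1 hind
  have := Measure.isProbabilityMeasure_map (μ := P) hζ.aemeasurable
  have := Measure.isProbabilityMeasure_map (μ := P) hY.aemeasurable
  rw [← lintegral_map hG (hY.prodMk hζ), h1, lintegral_prod _ hG.aemeasurable,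
    lintegral_map hG.lintegral_prod_right' hY]

/-- Uniform exponential moment bound for a contraction driven by small centered noise. -/
theorem lintegral_exp_softNorm_recursion_le {d : ℕ} {D : Measure Ξ} [IsProbabilityMeasure D]
    [IsProbabilityMeasure P]
    (hξ : ∀ t, Measurable (ξ t)) (hlaw : ∀ t, P.map (ξ t) = D)
    {e : X → Ξ → Vec d} (hm : Measurable (Function.uncurry e)) (he : ∀ x s, ‖e x s‖ ≤ 1 / 3)
    (he0 : ∀ x, ∫ s, e x s ∂D = 0) {a : ℝ} (ha0 : 0 ≤ a) (ha1 : a ≤ 1)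
    (he2 : ∀ x, ∫ s, ‖e x s‖ ^ 2 ∂D ≤ a / 4) {Y : ℕ → Ω → X} {M : ℕ → Ω → Vec d}
    (hYM : ∀ t, Measurable fun ω => (Y t ω, M t ω))
    (hind : ∀ t, IndepFun (fun ω => (Y t ω, M t ω)) (ξ (t + 1)) P)
    (hM0 : ∀ ω, M 0 ω = 0)
    (hM : ∀ t ω, M (t + 1) ω = (1 - a) • M t ω + e (Y t ω) (ξ (t + 1) ω)) (t : ℕ) :
    ∫⁻ ω, ENNReal.ofReal (Real.exp (softNorm (M t ω))) ∂P ≤ ENNReal.ofReal (Real.exp 2) := by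
  induction t with
  | zero =>
    simp only [hM0, softNorm, norm_zero, ne_eq, OfNat.ofNat_ne_zero, not_false_eq_true, zero_pow,
      add_zero, Real.sqrt_one, lintegral_const, measure_univ, mul_one]
    exact ENNReal.ofReal_le_ofReal (Real.exp_le_exp.2 one_le_two)
  | succ t ih =>
    have hG : Measurable fun w : (X × Vec d) × Ξ =>
        ENNReal.ofReal (Real.exp (softNorm ((1 - a) • w.1.2 + e w.1.1 w.2))) := by
      refine (Real.measurable_exp.comp (measurable_softNorm.comp ?_)).ennreal_ofReal
      exact (measurable_fst.snd.const_smul (1 - a)).add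
        (hm.comp (measurable_fst.fst.prodMk measurable_snd))
    have h1 := lintegral_comp_of_indepFun (hYM t) (hξ (t + 1)) (hind t) hG
    simp only [hlaw] at h1
    simp only [hM]
    rw [h1]
    calc _ ≤ ∫⁻ ω, ENNReal.ofReal ((1 - a) * Real.exp (softNorm (M t ω)) + a * Real.exp 2) ∂P :=
          lintegral_mono fun ω => lintegral_exp_softNorm_le (hm.comp measurable_prodMk_left)
            (he _) (he0 _) ha0 ha1 (he2 _) _
      _ = ENNReal.ofReal (1 - a) * ∫⁻ ω, ENNReal.ofReal (Real.exp (softNorm (M t ω))) ∂P +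
          ENNReal.ofReal (a * Real.exp 2) := by
          have h2 : ∀ ω, ENNReal.ofReal ((1 - a) * Real.exp (softNorm (M t ω)) + a * Real.exp 2) =
              ENNReal.ofReal (1 - a) * ENNReal.ofReal (Real.exp (softNorm (M t ω))) +
                ENNReal.ofReal (a * Real.exp 2) := fun ω => by
            rw [ENNReal.ofReal_add (mul_nonneg (sub_nonneg.2 ha1) (Real.exp_pos _).le)
              (mul_nonneg ha0 (Real.exp_pos _).le), ENNReal.ofReal_mul (sub_nonneg.2 ha1)]
          simp_rw [h2]
          rw [lintegral_add_right _ measurable_const, lintegral_const_mul' _ _ ENNReal.ofReal_ne_top,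
            lintegral_const, measure_univ, mul_one]
      _ ≤ ENNReal.ofReal (1 - a) * ENNReal.ofReal (Real.exp 2) +
          ENNReal.ofReal (a * Real.exp 2) := by gcongr
      _ = ENNReal.ofReal (Real.exp 2) := by
          rw [← ENNReal.ofReal_mul (sub_nonneg.2 ha1), ← ENNReal.ofReal_add
            (mul_nonneg (sub_nonneg.2 ha1) (Real.exp_pos _).le)
            (mul_nonneg ha0 (Real.exp_pos _).le)]
          congr 1
          ring

/-- Markov's inequality and a union bound for finitely many exponential moments. -/
theorem measureReal_exists_lt_norm_le [IsProbabilityMeasure P] {d : ℕ} {M : ℕ → Ω → Vec d}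
    (hM : ∀ t, Measurable (M t))
    (hexp : ∀ t, ∫⁻ ω, ENNReal.ofReal (Real.exp (softNorm (M t ω))) ∂P ≤
      ENNReal.ofReal (Real.exp 2)) {T : ℕ} (hT : 1 ≤ T) {β : ℝ} (hβ : 0 < β) :
    P.real (⋃ t ∈ Finset.range T, {ω | 2 + Real.log (T / β) ≤ ‖M t ω‖}) ≤ β := by
  have hT0 : (0 : ℝ) < T := by exact_mod_cast hT
  -- Markov's inequality: e² divided by exp(2 + log(T/β)) is exactly β/T.
  have h1 : ∀ t, P.real {ω | 2 + Real.log (T / β) ≤ ‖M t ω‖} ≤ β / T := by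
    intro t
    have hmk := mul_meas_ge_le_lintegral (μ := P)
      (f := fun ω => ENNReal.ofReal (Real.exp (softNorm (M t ω))))
      (Real.measurable_exp.comp (measurable_softNorm.comp (hM t))).ennreal_ofReal
      (ENNReal.ofReal (Real.exp (2 + Real.log (T / β))))
    have hsub : {ω | 2 + Real.log (T / β) ≤ ‖M t ω‖} ⊆
        {ω | ENNReal.ofReal (Real.exp (2 + Real.log (T / β))) ≤
          ENNReal.ofReal (Real.exp (softNorm (M t ω)))} := fun ω hω =>
      ENNReal.ofReal_le_ofReal (Real.exp_le_exp.2 (le_trans hω (norm_le_softNorm _)))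
    have h2 : ENNReal.ofReal (Real.exp (2 + Real.log (T / β))) *
        P {ω | 2 + Real.log (T / β) ≤ ‖M t ω‖} ≤ ENNReal.ofReal (Real.exp 2) :=
      (mul_le_mul_right (measure_mono hsub) _).trans (hmk.trans (hexp t))
    have h3 := ENNReal.toReal_mono ENNReal.ofReal_ne_top h2
    rw [ENNReal.toReal_mul, ENNReal.toReal_ofReal (Real.exp_pos _).le,
      ENNReal.toReal_ofReal (Real.exp_pos _).le, Real.exp_add,
      Real.exp_log (by positivity), mul_assoc] at h3
    have h4 := le_of_mul_le_mul_left (h3.trans_eq (mul_one _).symm) (Real.exp_pos 2)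
    have h5 : P.real {ω | 2 + Real.log (T / β) ≤ ‖M t ω‖} =
        β / T * (T / β * P.real {ω | 2 + Real.log (T / β) ≤ ‖M t ω‖}) := by
      field_simp
    rw [h5]
    exact mul_le_of_le_one_right (by positivity) h4
  calc _ ≤ ∑ t ∈ Finset.range T, P.real {ω | 2 + Real.log (T / β) ≤ ‖M t ω‖} :=
        measureReal_biUnion_finset_le _ _
    _ ≤ ∑ t ∈ Finset.range T, β / T := Finset.sum_le_sum fun t _ => h1 t
    _ = β := by
        rw [Finset.sum_const, Finset.card_range, nsmul_eq_mul]
        field_simp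

end Chain

theorem iter_succ_eq_descend {d : ℕ} {Ξ : Type*} (gradf : Vec d → Ξ → Vec d) (α lam₁ lam₂ γ : ℝ)
    (x₀ g₀ : Vec d) (s : ℕ → Ξ) (t : ℕ) :
    iter gradf α lam₁ lam₂ γ x₀ g₀ s (t + 1) =
      descend γ (iter gradf α lam₁ lam₂ γ x₀ g₀ s t) (estimate gradf α lam₁ lam₂ γ x₀ g₀ s t) :=
  iter_succ ..

/-! ### The noise accumulated along a run. -/

section Chain

variable {d : ℕ} {Ξ : Type*} [MeasurableSpace Ξ] {D : Measure Ξ} {F : Vec d → ℝ}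
  {gradf : Vec d → Ξ → Vec d} {p q L σ₁ α lam₁ lam₂ γ : ℝ}

/-- The exponentially weighted sum of the noise along a run, divided by `S`. -/
noncomputable def noiseSum (D : Measure Ξ) (F : Vec d → ℝ) (gradf : Vec d → Ξ → Vec d)
    (α lam₁ lam₂ γ : ℝ) (x₀ g₀ : Vec d) (S : ℝ) (s : ℕ → Ξ) : ℕ → Vec d
  | 0 => 0
  | t + 1 => (1 - α) • noiseSum D F gradf α lam₁ lam₂ γ x₀ g₀ S s t +
      S⁻¹ • noise D F gradf α lam₁ lam₂ γ (run gradf α lam₁ lam₂ γ x₀ g₀ s t).x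
        (run gradf α lam₁ lam₂ γ x₀ g₀ s t).next (s (t + 1))

theorem measurable_descend (γ : ℝ) :
    Measurable fun w : Vec d × Vec d => descend γ w.1 w.2 := by
  unfold descend
  exact measurable_fst.sub ((measurable_snd.norm.inv.smul measurable_snd).const_smul γ)

/-- One step of the algorithm together with its accumulated noise. -/
noncomputable def chainStep (D : Measure Ξ) (F : Vec d → ℝ) (gradf : Vec d → Ξ → Vec d)
    (α lam₁ lam₂ γ S : ℝ) (z : ((Vec d × Vec d) × Vec d) × Vec d) (s : Ξ) :
    ((Vec d × Vec d) × Vec d) × Vec d :=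
  (((z.1.1.2, descend γ z.1.1.2 (updateEstimate gradf α lam₁ lam₂ z.1.2 z.1.1.1 z.1.1.2 s)),
    updateEstimate gradf α lam₁ lam₂ z.1.2 z.1.1.1 z.1.1.2 s),
    (1 - α) • z.2 + S⁻¹ • noise D F gradf α lam₁ lam₂ γ z.1.1.1 z.1.1.2 s)

theorem measurable_chainStep_comp [IsProbabilityMeasure D]
    (hm : Measurable (Function.uncurry gradf)) (hg : Measurable (gradient F)) (S : ℝ)
    {W : Type*} [MeasurableSpace W] {x y g m : W → Vec d} {s : W → Ξ} (hx : Measurable x)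
    (hy : Measurable y) (hgr : Measurable g) (hmn : Measurable m) (hs : Measurable s) :
    Measurable fun w =>
      chainStep D F gradf α lam₁ lam₂ γ S (((x w, y w), g w), m w) (s w) := by
  have hpair : Measurable fun w => ((x w, y w), s w) := (hx.prodMk hy).prodMk hs
  have hA : Measurable fun w => clip (gradf (y w) (s w) - gradf (x w) (s w)) lam₁ :=
    ((measurable_clip_diff hm lam₁).comp hpair :)
  have hB : Measurable fun w => clip (gradf (y w) (s w)) lam₂ :=
    ((measurable_clip_grad hm lam₂).comp hpair :)
  have hu : Measurable fun w => updateEstimate gradf α lam₁ lam₂ (g w) (x w) (y w) (s w) :=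
    ((hgr.add hA).const_smul (1 - α)).add (hB.const_smul α)
  have hn : Measurable fun w => noise D F gradf α lam₁ lam₂ γ (x w) (y w) (s w) :=
    ((measurable_noise (D := D) (α := α) (lam₁ := lam₁) (lam₂ := lam₂) (γ := γ) hm hg).comp hpair :)
  have hd : Measurable fun w => descend γ (y w)
      (updateEstimate gradf α lam₁ lam₂ (g w) (x w) (y w) (s w)) :=
    (measurable_descend (d := d) γ).comp (hy.prodMk hu)
  have hM : Measurable fun w => (1 - α) • m w +
      S⁻¹ • noise D F gradf α lam₁ lam₂ γ (x w) (y w) (s w) :=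
    (hmn.const_smul (1 - α)).add (hn.const_smul S⁻¹)
  exact ((hy.prodMk hd).prodMk hu).prodMk hM

theorem measurable_chainStep [IsProbabilityMeasure D] (hm : Measurable (Function.uncurry gradf))
    (hg : Measurable (gradient F)) (S : ℝ) :
    Measurable (Function.uncurry (chainStep D F gradf α lam₁ lam₂ γ S)) :=
  measurable_chainStep_comp hm hg S measurable_fst.fst.fst.fst measurable_fst.fst.fst.snd
    measurable_fst.fst.snd measurable_fst.snd measurable_snd

theorem BoundedCentralMoment.measurable_gradient [IsProbabilityMeasure D]
    (hB : BoundedCentralMoment D F gradf p σ₁)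
    (hW : WeakAverageSmooth D gradf q L) (hq : 1 ≤ q) (hL : 0 < L) : Measurable (gradient F) := by
  have h : LipschitzWith L.toNNReal (gradient F) := .of_dist_le_mul fun x y => by
    rw [dist_eq_norm, dist_eq_norm, Real.coe_toNNReal _ hL.le]
    exact hB.lipschitz_gradient hW hq hL x y
  exact h.continuous.measurable

/-- With probability `1 - β`, the accumulated noise stays below `2 + log (T / β)`. -/
theorem measureReal_noiseSum_le [IsProbabilityMeasure D] {Ω : Type*} [MeasurableSpace Ω]
    {P : Measure Ω} [IsProbabilityMeasure P] {ξ : ℕ → Ω → Ξ}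
    (hB : BoundedCentralMoment D F gradf p σ₁)
    (hW : WeakAverageSmooth D gradf q L) (hm : Measurable (Function.uncurry gradf))
    (hp : 1 ≤ p) (hp2 : p ≤ 2) (hq : 1 ≤ q) (hq2 : q ≤ 2) (hL : 0 < L)
    (hα0 : 0 ≤ α) (hα1 : α ≤ 1) (h₁ : 0 < lam₁) (h₂ : 0 < lam₂)
    (hlam₁ : (L * γ) ^ q ≤ α * lam₁ ^ q) (hlam₂ : σ₁ ^ p ≤ α * lam₂ ^ p)
    (hξ : ∀ t, Measurable (ξ t)) (hlaw : ∀ t, P.map (ξ t) = D) (hind : iIndepFun ξ P)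
    (x₀ g₀ : Vec d) {T : ℕ} (hT : 1 ≤ T) {β : ℝ} (hβ : 0 < β) :
    P.real (⋃ t ∈ Finset.range T, {ω | 2 + Real.log (T / β) ≤
      ‖noiseSum D F gradf α lam₁ lam₂ γ x₀ g₀ (6 * (lam₁ + α * lam₂)) (fun t => ξ t ω) t‖}) ≤
      β := by
  have hg := hB.measurable_gradient hW hq hL
  -- The scaled noise is then at most 2/6 = 1/3 in norm, with second moment at most 8α/36 ≤ α/4.
  set S := 6 * (lam₁ + α * lam₂) with hS
  have hS0 : 0 < S := by positivity
  set M : ℕ → Ω → Vec d := fun t ω =>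
    noiseSum D F gradf α lam₁ lam₂ γ x₀ g₀ S (fun t => ξ t ω) t
  set R : ℕ → Ω → State d := fun t ω => run gradf α lam₁ lam₂ γ x₀ g₀ (fun t => ξ t ω) t
  -- The state carries the accumulated noise along, so that both together form one recursion driven
  -- by the samples.
  set Z : ℕ → Ω → ((Vec d × Vec d) × Vec d) × Vec d := fun t ω =>
    ((((R t ω).x, (R t ω).next), (R t ω).g), M t ω)
  have hZ := measurable_and_indepFun_of_recursion hξ hind
    (measurable_chainStep (D := D) (α := α) (lam₁ := lam₁) (lam₂ := lam₂) (γ := γ) hm hg S)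
    (Y := Z) (((x₀, descend γ x₀ g₀), g₀), 0) (fun _ => rfl) (fun _ _ => rfl)
  have hpr : Measurable fun z : ((Vec d × Vec d) × Vec d) × Vec d => (z.1.1, z.2) :=
    measurable_fst.fst.prodMk measurable_snd
  refine measureReal_exists_lt_norm_le (M := M) (fun t => (hZ t).1.snd)
    (lintegral_exp_softNorm_recursion_le hξ hlaw
      (e := fun (w : Vec d × Vec d) s => S⁻¹ • noise D F gradf α lam₁ lam₂ γ w.1 w.2 s)
      ((measurable_noise hm hg).const_smul S⁻¹) ?_ ?_ hα0 hα1 ?_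
      (Y := fun t ω => ((R t ω).x, (R t ω).next)) (fun t => hpr.comp (hZ t).1)
      (fun t => (hZ t).2.comp hpr measurable_id) (fun _ => rfl) (fun _ _ => rfl)) hT hβ
  · intro w s
    rw [norm_smul, norm_inv, Real.norm_of_nonneg hS0.le, inv_mul_le_iff₀ hS0]
    have := norm_noise_le (D := D) (F := F) (gradf := gradf) (γ := γ) hα0 hα1 h₁.le h₂.le w.1 w.2 s
    linarith
  · intro w
    rw [integral_smul, integral_noise hm h₁.le h₂.le, smul_zero]
  · intro w
    have h3 : ∀ s, ‖S⁻¹ • noise D F gradf α lam₁ lam₂ γ w.1 w.2 s‖ ^ 2 =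
        (S ^ 2)⁻¹ * ‖noise D F gradf α lam₁ lam₂ γ w.1 w.2 s‖ ^ 2 := fun s => by
      rw [norm_smul, norm_inv, Real.norm_of_nonneg hS0.le, mul_pow, inv_pow]
    simp_rw [h3]
    rw [integral_const_mul, inv_mul_le_iff₀ (by positivity)]
    refine (integral_norm_noise_sq_le hB hW hm hp hp2 hq hq2 hL hα0 hα1 h₁ h₂ hlam₁ hlam₂
      w.1 w.2).trans ?_
    have : 0 ≤ α * (lam₁ + α * lam₂) ^ 2 := by positivity
    rw [hS]
    linarith

end Chain

/-! ### Progress of a run on the event of small noise. -/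

section Deterministic

variable {d : ℕ} {Ξ : Type*} [MeasurableSpace Ξ] {D : Measure Ξ} [IsProbabilityMeasure D]
  {F : Vec d → ℝ} {gradf : Vec d → Ξ → Vec d} {p q L σ₁ α lam₁ lam₂ γ : ℝ}

/-- A bias of αb per step keeps the level b = lam₁ + 2α lam₂ invariant, as (1 - α)b + αb = b. Since
g₀ = 0, the initial error is ‖∇F(x₀)‖, and it decays geometrically. -/
theorem norm_estimate_sub_le (hB : BoundedCentralMoment D F gradf p σ₁)
    (hW : WeakAverageSmooth D gradf q L) (hm : Measurable (Function.uncurry gradf))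
    (hp : 1 ≤ p) (hp2 : p ≤ 2) (hq : 1 ≤ q) (hq2 : q ≤ 2) (hL : 0 < L)
    (hα0 : 0 ≤ α) (hα1 : α ≤ 1) (h₁ : 0 < lam₁) (h₂ : 0 < lam₂) (hγ : 0 ≤ γ)
    (hlam₁ : (L * γ) ^ q ≤ α * lam₁ ^ q) (hlam₂ : σ₁ ^ p ≤ α * lam₂ ^ p)
    (x₀ : Vec d) {S : ℝ} (hS : S ≠ 0) (s : ℕ → Ξ) (t : ℕ)
    (ht : ∀ r ≤ t, ‖gradient F (iter gradf α lam₁ lam₂ γ x₀ 0 s r)‖ ≤ lam₂ / 2) :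
    ‖estimate gradf α lam₁ lam₂ γ x₀ 0 s t - gradient F (iter gradf α lam₁ lam₂ γ x₀ 0 s t) -
      S • noiseSum D F gradf α lam₁ lam₂ γ x₀ 0 S s t‖ ≤
      (1 - α) ^ t * ‖gradient F x₀‖ + (lam₁ + 2 * α * lam₂) := by
  induction t with
  | zero =>
    have : 0 ≤ lam₁ + 2 * α * lam₂ := by positivity
    simpa [estimate, iter, run, noiseSum] using this
  | succ t ih =>
    have ih' := ih fun r hr => ht r (hr.trans t.le_succ)
    have hxy : ‖iter gradf α lam₁ lam₂ γ x₀ 0 s (t + 1) - iter gradf α lam₁ lam₂ γ x₀ 0 s t‖ ≤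
        γ := by
      rw [iter_succ_eq_descend]
      exact norm_descend_sub_le hγ _ _
    have h3 := norm_updateEstimate_sub_le hB hW hm hp hp2 hq hq2 hL hα0 hα1 h₁ h₂ hlam₁ hlam₂ hxy
      (ht (t + 1) le_rfl) (estimate gradf α lam₁ lam₂ γ x₀ 0 s t)
      (S • noiseSum D F gradf α lam₁ lam₂ γ x₀ 0 S s t) (s (t + 1))
    have h4 : S • noiseSum D F gradf α lam₁ lam₂ γ x₀ 0 S s (t + 1) =
        (1 - α) • S • noiseSum D F gradf α lam₁ lam₂ γ x₀ 0 S s t +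
          noise D F gradf α lam₁ lam₂ γ (iter gradf α lam₁ lam₂ γ x₀ 0 s t)
            (iter gradf α lam₁ lam₂ γ x₀ 0 s (t + 1)) (s (t + 1)) := by
      rw [noiseSum, smul_add, smul_inv_smul₀ hS, smul_comm S (1 - α)]
      rfl
    rw [h4]
    refine h3.trans ?_
    have h5 := mul_le_mul_of_nonneg_left ih' (sub_nonneg.2 hα1)
    rw [pow_succ']
    linarith

/-- If the accumulated noise is small and the stepsize fits the budget, then the run makes
progress. -/
theorem sum_norm_gradient_le (hF : Differentiable ℝ F) (hb : BddBelow (Set.range F))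
    (hB : BoundedCentralMoment D F gradf p σ₁)
    (hW : WeakAverageSmooth D gradf q L) (hm : Measurable (Function.uncurry gradf))
    (hp : 1 ≤ p) (hp2 : p ≤ 2) (hq : 1 ≤ q) (hq2 : q ≤ 2) (hL : 0 < L)
    (hα0 : 0 < α) (hα1 : α ≤ 1) (h₁ : 0 < lam₁) (h₂ : 0 < lam₂) (hγ : 0 ≤ γ)
    (hlam₁ : (L * γ) ^ q ≤ α * lam₁ ^ q) (hlam₂ : σ₁ ^ p ≤ α * lam₂ ^ p)
    (x₀ : Vec d) {S : ℝ} (hS : 0 < S) (s : ℕ → Ξ) {T : ℕ} {R : ℝ}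
    (hgrad : ∀ x, subopt F x ≤ 2 * subopt F x₀ → ‖gradient F x‖ ≤ lam₂ / 2)
    (hR : ∀ t < T, ‖noiseSum D F gradf α lam₁ lam₂ γ x₀ 0 S s t‖ ≤ R)
    (hbud : 2 * γ * (‖gradient F x₀‖ / α + T * (lam₁ + 2 * α * lam₂ + S * R)) +
      L / 2 * γ ^ 2 * T ≤ subopt F x₀) :
    γ * ∑ t ∈ Finset.range T, ‖gradient F (iter gradf α lam₁ lam₂ γ x₀ 0 s t)‖ ≤
      2 * subopt F x₀ := by
  set x := iter gradf α lam₁ lam₂ γ x₀ 0 s with hx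
  set g := estimate gradf α lam₁ lam₂ γ x₀ 0 s with hg
  have hlip := hB.lipschitz_gradient hW hq hL
  have hsub : ∀ y, 0 ≤ subopt F y := fun y => sub_nonneg.2 (ciInf_le hb y)
  set b := lam₁ + 2 * α * lam₂ + S * R with hb'
  -- Bootstrap: the bound at times before n keeps those gradients below lam₂/2, so the error
  -- estimates hold up to time n - 1; summing the descent inequality within the budget returns the
  -- bound at n.
  have key : ∀ n ≤ T, subopt F (x n) + γ * ∑ t ∈ Finset.range n, ‖gradient F (x t)‖ ≤
      2 * subopt F x₀ := by
    intro n
    induction n using Nat.strong_induction_on with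
    | _ n ih =>
    intro hn
    have hsmall : ∀ r < n, ‖gradient F (x r)‖ ≤ lam₂ / 2 := by
      intro r hr
      have h3 := ih r hr (hr.le.trans hn)
      have h4 : 0 ≤ γ * ∑ t ∈ Finset.range r, ‖gradient F (x t)‖ := by positivity
      exact hgrad _ (by linarith)
    have herr : ∀ t < n, ‖g t - gradient F (x t)‖ ≤ (1 - α) ^ t * ‖gradient F x₀‖ + b := by
      intro t ht
      have h3 := norm_estimate_sub_le hB hW hm hp hp2 hq hq2 hL hα0.le hα1 h₁ h₂ hγ hlam₁ hlam₂
        x₀ hS.ne' s t (fun r hr => hsmall r (hr.trans_lt ht))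
      have h4 : ‖S • noiseSum D F gradf α lam₁ lam₂ γ x₀ 0 S s t‖ ≤ S * R := by
        rw [norm_smul, Real.norm_of_nonneg hS.le]
        exact mul_le_mul_of_nonneg_left (hR t (ht.trans_le hn)) hS.le
      have h5 := norm_le_norm_sub_add (g t - gradient F (x t))
        (S • noiseSum D F gradf α lam₁ lam₂ γ x₀ 0 S s t)
      linarith
    have hdesc : ∀ k ≤ n, F (x k) + γ * ∑ t ∈ Finset.range k, ‖gradient F (x t)‖ ≤
        F x₀ + 2 * γ * ∑ t ∈ Finset.range k, ((1 - α) ^ t * ‖gradient F x₀‖ + b) +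
          L / 2 * γ ^ 2 * k := by
      intro k
      induction k with
      | zero =>
        intro _
        have : x 0 = x₀ := rfl
        simp [this]
      | succ k ihk =>
        intro hk
        have h3 := ihk (Nat.le_of_succ_le hk)
        have h4 := descend_le hF hL hlip hγ (x k) (g k)
        have h5 : x (k + 1) = descend γ (x k) (g k) := iter_succ_eq_descend ..
        have h6 := mul_le_mul_of_nonneg_left (herr k hk) (mul_nonneg zero_le_two hγ)
        rw [h5, Finset.sum_range_succ, Finset.sum_range_succ, Nat.cast_succ]
        linarith
    have hgeom : ∑ t ∈ Finset.range n, (1 - α) ^ t ≤ 1 / α := by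
      rw [le_div_iff₀ hα0, mul_comm]
      have h3 := mul_neg_geom_sum (1 - α) n
      rw [sub_sub_cancel] at h3
      have h4 : 0 ≤ (1 - α) ^ n := pow_nonneg (sub_nonneg.2 hα1) n
      linarith
    -- Nonnegativity of R is not assumed; the noise bound at time 0 supplies it unless T = 0.
    have hR0 : 0 ≤ n * b ∧ (n : ℝ) * b ≤ T * b := by
      rcases Nat.eq_zero_or_pos n with rfl | hn0
      · rcases Nat.eq_zero_or_pos T with rfl | hT0
        · simp
        · have h3 := (norm_nonneg _).trans (hR 0 hT0)
          simp only [Nat.cast_zero, zero_mul, le_refl, true_and]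
          positivity
      · have h3 := (norm_nonneg _).trans (hR 0 (hn0.trans_le hn))
        have h4 : 0 ≤ b := by positivity
        have h5 : (n : ℝ) ≤ T := by exact_mod_cast hn
        exact ⟨by positivity, by gcongr⟩
    have hsum : ∑ t ∈ Finset.range n, ((1 - α) ^ t * ‖gradient F x₀‖ + b) ≤
        ‖gradient F x₀‖ / α + T * b := by
      rw [Finset.sum_add_distrib, ← Finset.sum_mul, Finset.sum_const, Finset.card_range,
        nsmul_eq_mul]
      have h3 := mul_le_mul_of_nonneg_right hgeom (norm_nonneg (gradient F x₀))
      rw [one_div_mul_eq_div] at h3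
      linarith [hR0.2]
    have h3 := hdesc n le_rfl
    have h4 := mul_le_mul_of_nonneg_left hsum (mul_nonneg zero_le_two hγ)
    have h5 : L / 2 * γ ^ 2 * n ≤ L / 2 * γ ^ 2 * T := by gcongr
    have h6 : subopt F (x n) = F (x n) - F x₀ + subopt F x₀ := by
      unfold subopt
      ring
    linarith
  have := key T le_rfl
  linarith [hsub (x T)]

end Deterministic

/-! ### Momentum, thresholds and stepsize. -/

section Parameters

variable {p q L σ₁ Δ α γ l : ℝ} {T : ℕ}

theorem momentum_denom_pos (hp : 1 < p) (hq : 1 ≤ q) : 0 < p * (2 * q + 1) - 2 * q := by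
  nlinarith

theorem momentum_pos (hT : 1 ≤ T) : 0 < momentum p q T := by
  have hT0 : (0 : ℝ) < T := by exact_mod_cast hT
  exact lt_max_of_lt_left (Real.rpow_pos_of_pos hT0 _)

theorem momentum_le_one (hp : 1 < p) (hq : 1 ≤ q) (hT : 1 ≤ T) : momentum p q T ≤ 1 := by
  have hT1 : (1 : ℝ) ≤ T := by exact_mod_cast hT
  have hD := momentum_denom_pos hp hq
  have h2 : 0 < 2 * p - 1 := by linarith
  have hp0 : 0 < p := by linarith
  have hq0 : 0 < q := by linarith
  refine max_le (Real.rpow_le_one_of_one_le_of_nonpos hT1 ?_)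
    (Real.rpow_le_one_of_one_le_of_nonpos hT1 ?_)
  · exact neg_nonpos.2 (by positivity)
  · exact neg_nonpos.2 (by positivity)

/-- The exponent of `T` in the rate. -/
noncomputable def rateExponent (p q : ℝ) : ℝ :=
  min ((p - 1) / (2 * p - 1)) (q * (p - 1) / (p * (2 * q + 1) - 2 * q))

theorem rpow_rateExponent_le_sqrt (hp : 1 < p) (hT : 1 ≤ T) :
    (T : ℝ) ^ rateExponent p q ≤ √T := by
  have hT1 : (1 : ℝ) ≤ T := by exact_mod_cast hT
  rw [Real.sqrt_eq_rpow]
  refine Real.rpow_le_rpow_of_exponent_le hT1 ((min_le_left _ _).trans ?_)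
  rw [div_le_div_iff₀ (by linarith) two_pos]
  linarith

/-- The first candidate for α solves αT · α^((p-1)/p) = 1, and both factors are then powers of T
with exponent ±(p-1)/(2p-1). -/
theorem rpow_rateExponent_le_mul (hp : 1 < p) (hT : 1 ≤ T) :
    (T : ℝ) ^ rateExponent p q ≤ momentum p q T * T := by
  have hT1 : (1 : ℝ) ≤ T := by exact_mod_cast hT
  have h2 : 2 * p - 1 ≠ 0 := by linarith
  calc (T : ℝ) ^ rateExponent p q ≤ (T : ℝ) ^ (-(p / (2 * p - 1)) + 1) := by
        refine Real.rpow_le_rpow_of_exponent_le hT1 ((min_le_left _ _).trans_eq ?_)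
        rw [← neg_div, div_add_one h2]
        ring
    _ = (T : ℝ) ^ (-(p / (2 * p - 1))) * T := by
        rw [Real.rpow_add (by linarith), Real.rpow_one]
    _ ≤ _ := by
        gcongr
        exact le_max_left _ _

/-- The second candidate for α solves α^(1/q) T = α^(-2(p-1)/p), which balances the difference noise
against the gradient noise. -/
theorem sq_rpow_rateExponent_le (hp : 1 < p) (hq : 1 ≤ q) (hT : 1 ≤ T) :
    ((T : ℝ) ^ rateExponent p q) ^ 2 ≤ momentum p q T ^ (1 / q) * T := by
  have hT1 : (1 : ℝ) ≤ T := by exact_mod_cast hT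
  have hT0 : (0 : ℝ) < T := by linarith
  have hD := momentum_denom_pos hp hq
  have hq0 : 0 < q := by linarith
  set Dn := p * (2 * q + 1) - 2 * q with hDn
  calc ((T : ℝ) ^ rateExponent p q) ^ 2 = (T : ℝ) ^ (rateExponent p q * 2) := by
        rw [← Real.rpow_natCast, ← Real.rpow_mul hT0.le]
        norm_num
    _ ≤ (T : ℝ) ^ (-(p * q / Dn) * (1 / q) + 1) := by
        refine Real.rpow_le_rpow_of_exponent_le hT1
          ((mul_le_mul_of_nonneg_right (min_le_right _ _) zero_le_two).trans_eq ?_)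
        rw [← hDn]
        field_simp
        rw [hDn]
        ring
    _ = ((T : ℝ) ^ (-(p * q / Dn))) ^ (1 / q) * T := by
        rw [Real.rpow_add hT0, Real.rpow_one, Real.rpow_mul hT0.le]
    _ ≤ _ := by
        gcongr
        exact le_max_right _ _

/-- An upper bound on α is needed here, so both candidates must be treated; each has its own term of
the minimum as its exponent. -/
theorem momentum_rpow_mul_le_one (hp : 1 < p) (hq : 1 ≤ q) (hT : 1 ≤ T) :
    momentum p q T ^ ((p - 1) / p) * (T : ℝ) ^ rateExponent p q ≤ 1 := by
  have hT1 : (1 : ℝ) ≤ T := by exact_mod_cast hT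
  have hT0 : (0 : ℝ) < T := by linarith
  have hD := momentum_denom_pos hp hq
  have h2 : 2 * p - 1 ≠ 0 := by linarith
  have hp0 : p ≠ 0 := by linarith
  rcases max_choice ((T : ℝ) ^ (-(p / (2 * p - 1))))
    ((T : ℝ) ^ (-(p * q / (p * (2 * q + 1) - 2 * q)))) with h | h
  · unfold momentum
    rw [h, ← Real.rpow_mul hT0.le, ← Real.rpow_add hT0]
    refine Real.rpow_le_one_of_one_le_of_nonpos hT1 ?_
    have h3 : -(p / (2 * p - 1)) * ((p - 1) / p) = -((p - 1) / (2 * p - 1)) := by field_simp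
    have h4 : rateExponent p q ≤ (p - 1) / (2 * p - 1) := min_le_left _ _
    linarith
  · unfold momentum
    rw [h, ← Real.rpow_mul hT0.le, ← Real.rpow_add hT0]
    refine Real.rpow_le_one_of_one_le_of_nonpos hT1 ?_
    have h3 : -(p * q / (p * (2 * q + 1) - 2 * q)) * ((p - 1) / p) =
        -(q * (p - 1) / (p * (2 * q + 1) - 2 * q)) := by field_simp
    have h4 : rateExponent p q ≤ q * (p - 1) / (p * (2 * q + 1) - 2 * q) := min_le_right _ _
    linarith

theorem sqrt_div_mul_sqrt_mul (hL : 0 < L) (hΔ : 0 ≤ Δ) : √(Δ / L) * √(L * Δ) = Δ := by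
  rw [← Real.sqrt_mul (by positivity), show Δ / L * (L * Δ) = Δ ^ 2 by field_simp,
    Real.sqrt_sq hΔ]

theorem stepScale_pos (hL : 0 < L) (hσ : 0 < σ₁) (hΔ : 0 < Δ) (hα : 0 < α) (hT : 1 ≤ T)
    (hl : 0 < l) : 0 < stepScale p q L σ₁ Δ α T l := by
  have hT0 : (0 : ℝ) < T := by exact_mod_cast hT
  unfold stepScale
  refine lt_min ?_ (lt_min ?_ (lt_min ?_ (lt_min ?_ ?_))) <;> positivity

/-- The stepsize scale is large enough for the claimed rate. -/
theorem le_stepScale_mul_rate (hp : 1 < p) (hq : 1 ≤ q) (hL : 0 < L) (hσ : 0 < σ₁) (hΔ : 0 < Δ)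
    (hT : 1 ≤ T) (hl : 1 ≤ l) :
    Δ ≤ stepScale p q L σ₁ Δ (momentum p q T) T l * (T * (rate p q L σ₁ Δ T * l)) := by
  have hT0 : (0 : ℝ) < T := by exact_mod_cast hT
  have hα := momentum_pos (p := p) (q := q) hT
  have hα1 := momentum_le_one hp hq hT
  have e1 := rpow_rateExponent_le_sqrt (q := q) hp hT
  have e2 := rpow_rateExponent_le_mul (q := q) hp hT
  have e4 := momentum_rpow_mul_le_one hp hq hT
  have e5 := sq_rpow_rateExponent_le hp hq hT
  set a := momentum p q T
  set E := (T : ℝ) ^ rateExponent p q with hE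
  have hE0 : 0 < E := Real.rpow_pos_of_pos hT0 _
  have hrate : rate p q L σ₁ Δ T = (√(L * Δ) + σ₁) / E := rfl
  have hA : 0 < √(L * Δ) := by positivity
  have hs := sqrt_div_mul_sqrt_mul hL hΔ.le
  have hs0 : 0 < √(Δ / L) := by positivity
  have hr : √(L * Δ) / E ≤ (√(L * Δ) + σ₁) / E := by gcongr; linarith
  have hr' : σ₁ / E ≤ (√(L * Δ) + σ₁) / E := by gcongr; linarith
  have hB0 : 0 < a ^ ((p - 1) / p) := Real.rpow_pos_of_pos hα _
  have e3 : a * E ≤ 1 := by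
    refine (mul_le_mul_of_nonneg_right ?_ hE0.le).trans e4
    calc a = a ^ (1 : ℝ) := (Real.rpow_one a).symm
      _ ≤ _ := Real.rpow_le_rpow_of_exponent_ge hα hα1 (by
        rw [div_le_one (by linarith)]
        linarith)
  rw [hrate]
  set ρ := (√(L * Δ) + σ₁) / E with hρ
  have hρ0 : 0 < ρ := by positivity
  have hl0 : 0 < l := by linarith
  have hpos : 0 < T * (ρ * l) := by positivity
  rw [← div_le_iff₀ hpos]
  unfold stepScale
  have hAρ : √(L * Δ) ≤ ρ * E := by rwa [div_le_iff₀ hE0] at hr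
  have hσρ : σ₁ ≤ ρ * E := by rwa [div_le_iff₀ hE0] at hr'
  have hΔρ : Δ ≤ √(Δ / L) * (ρ * E) := by
    calc Δ = √(Δ / L) * √(L * Δ) := hs.symm
      _ ≤ _ := by gcongr
  -- With E the power of T in the rate, the five terms use in turn E ≤ √T, E ≤ αT, αE ≤ 1,
  -- α^((p-1)/p) E ≤ 1 and E² ≤ α^(1/q) T. Only the fourth draws on the σ₁ part of the rate.
  refine le_min ?_ (le_min ?_ (le_min ?_ (le_min ?_ ?_))) <;> rw [div_le_iff₀ hpos]
  · have h1 : √(Δ / (L * T)) = √(Δ / L) / √T := by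
      rw [← div_div, Real.sqrt_div' _ hT0.le]
    have h2 : √(Δ / L) / √T * (T * (ρ * l)) = √(Δ / L) * (ρ * √T) * l := by
      have : (T : ℝ) = √T * √T := (Real.mul_self_sqrt hT0.le).symm
      have h0 : √(T : ℝ) ≠ 0 := by positivity
      rw [div_mul_eq_mul_div, div_eq_iff h0]
      nth_rewrite 1 [this]
      ring
    rw [h1, h2]
    calc Δ ≤ √(Δ / L) * (ρ * E) * 1 := by rwa [mul_one]
      _ ≤ _ := by gcongr
  · calc Δ ≤ √(Δ / L) * (ρ * E) * 1 := by rwa [mul_one]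
      _ ≤ √(Δ / L) * (ρ * (a * T)) * l := by gcongr
      _ = _ := by ring
  · have h1 : 1 / (a * T * l) * √(Δ / L) * (T * (ρ * l)) = √(Δ / L) * (ρ * (1 / a)) := by
      field_simp
    rw [h1]
    refine hΔρ.trans ?_
    gcongr
    rwa [le_div_iff₀ hα, mul_comm]
  · have h1 : Δ / (σ₁ * a ^ ((p - 1) / p) * T * l) * (T * (ρ * l)) =
        Δ * (ρ * (1 / a ^ ((p - 1) / p)) / σ₁) := by
      field_simp
    rw [h1]
    refine le_mul_of_one_le_right hΔ.le ?_
    rw [one_le_div hσ]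
    refine hσρ.trans ?_
    gcongr
    rwa [le_div_iff₀ hB0, mul_comm]
  · have h0 : 0 ≤ a ^ (1 / q) := (Real.rpow_pos_of_pos hα _).le
    have h1 : √(Δ * a ^ (1 / q) / (L * T * l)) * (T * l) = √(Δ / L) * √(a ^ (1 / q) * T * l) := by
      rw [← Real.sqrt_sq (by positivity : 0 ≤ T * l), ← Real.sqrt_mul (by positivity), ← Real.sqrt_mul (by positivity)]
      congr 1
      field_simp
    have h2 : E ≤ √(a ^ (1 / q) * T * l) := by
      refine Real.le_sqrt_of_sq_le (e5.trans ?_)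
      exact le_mul_of_one_le_right (by positivity) hl
    calc Δ ≤ √(Δ / L) * (ρ * E) := hΔρ
      _ ≤ √(Δ / L) * (ρ * √(a ^ (1 / q) * T * l)) := by gcongr
      _ = (√(Δ / L) * √(a ^ (1 / q) * T * l)) * ρ := by ring
      _ = (√(Δ * a ^ (1 / q) / (L * T * l)) * (T * l)) * ρ := by rw [h1]
      _ = _ := by ring

/-- The factor α^(-1/q) in the threshold produces the α on the right; the factor 2 is slack. -/
theorem threshold₁_spec (hq : 1 ≤ q) (hL : 0 < L) (hγ : 0 < γ) (hα : 0 < α) :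
    (L * γ) ^ q ≤ α * threshold₁ q L α γ ^ q := by
  have hq0 : q ≠ 0 := by linarith
  unfold threshold₁
  rw [Real.mul_rpow (x := 2 * γ * L) (by positivity) (by positivity), ← Real.rpow_mul hα.le,
    show -(1 / q) * q = -1 by field_simp, Real.rpow_neg_one, mul_left_comm,
    mul_inv_cancel₀ hα.ne', mul_one]
  have : 0 < L * γ := by positivity
  refine Real.rpow_le_rpow this.le ?_ (by linarith)
  linarith

theorem threshold₂_spec (hp : 1 < p) (hσ : 0 < σ₁) (hα : 0 < α) :
    σ₁ ^ p ≤ α * threshold₂ p L σ₁ Δ α ^ p := by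
  have hp0 : p ≠ 0 := by linarith
  calc σ₁ ^ p = α * (σ₁ * α ^ (-(1 / p))) ^ p := by
        rw [Real.mul_rpow (by positivity) (by positivity), ← Real.rpow_mul hα.le,
          show -(1 / p) * p = -1 by field_simp, Real.rpow_neg_one, mul_left_comm,
          mul_inv_cancel₀ hα.ne', mul_one]
    _ ≤ _ := by
        gcongr
        exact le_max_right _ _

theorem mul_threshold₂_le (hp : 1 < p) (hσ : 0 < σ₁) (hα : 0 < α) :
    α * threshold₂ p L σ₁ Δ α ≤ 4 * (α * √(L * Δ)) + σ₁ * α ^ ((p - 1) / p) := by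
  have hp0 : p ≠ 0 := by linarith
  have h1 : α * (σ₁ * α ^ (-(1 / p))) = σ₁ * α ^ ((p - 1) / p) := by
    rw [mul_left_comm, show (p - 1) / p = 1 + -(1 / p) by field_simp; ring,
      Real.rpow_add hα, Real.rpow_one]
  have h2 : 0 ≤ α * √(L * Δ) := by positivity
  have h3 : 0 ≤ σ₁ * α ^ ((p - 1) / p) := by positivity
  unfold threshold₂
  rw [mul_max_of_nonneg _ _ hα.le, h1]
  exact max_le (by linarith) (by linarith)

/-- With a stepsize of at most a hundredth of the stepsize scale, the accumulated error of the
gradient estimates uses up at most the initial suboptimality. -/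
theorem budget_le (hp : 1 < p) (hL : 0 < L) (hσ : 0 < σ₁) (hΔ : 0 < Δ) (hα : 0 < α)
    (hT : 1 ≤ T) (hl : 2 ≤ l) (hγ : 0 < γ) (hγM : γ ≤ 1 / 100 * stepScale p q L σ₁ Δ α T l)
    {G R : ℝ} (hG : G ^ 2 ≤ 2 * L * Δ) (hR : R ≤ l) :
    2 * γ * (G / α + T * (threshold₁ q L α γ + 2 * α * threshold₂ p L σ₁ Δ α +
      6 * (threshold₁ q L α γ + α * threshold₂ p L σ₁ Δ α) * R)) + L / 2 * γ ^ 2 * T ≤ Δ := by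
  have hT0 : (0 : ℝ) < T := by exact_mod_cast hT
  have hl0 : 0 < l := by linarith
  have hs := sqrt_div_mul_sqrt_mul hL hΔ.le
  have hle : ∀ {x y : ℝ}, γ ≤ 1 / 100 * min x y → γ ≤ 1 / 100 * x ∧ γ ≤ 1 / 100 * y :=
    fun {x y} h => ⟨h.trans (by gcongr; exact min_le_left _ _),
      h.trans (by gcongr; exact min_le_right _ _)⟩
  unfold stepScale at hγM
  obtain ⟨g1, hγM⟩ := hle hγM
  obtain ⟨g2, hγM⟩ := hle hγM
  obtain ⟨g3, hγM⟩ := hle hγM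
  obtain ⟨g4, g5⟩ := hle hγM
  -- Each term of the stepsize scale pays for one loss: curvature, initial error, the two parts of
  -- lam₂, and lam₁. In total about 0.75 Δ is spent.
  have k1 : L * γ ^ 2 * T ≤ Δ / 10000 := by
    have h := pow_le_pow_left₀ hγ.le g1 2
    rw [mul_pow, Real.sq_sqrt (by positivity)] at h
    calc L * γ ^ 2 * T ≤ L * ((1 / 100) ^ 2 * (Δ / (L * T))) * T := by gcongr
      _ = _ := by field_simp; norm_num
  have k2 : γ * √(L * Δ) / α ≤ Δ / 100 := by
    rw [div_le_iff₀ hα]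
    calc γ * √(L * Δ) ≤ 1 / 100 * (α * √(Δ / L)) * √(L * Δ) := by gcongr
      _ = 1 / 100 * α * (√(Δ / L) * √(L * Δ)) := by ring
      _ = _ := by rw [hs]; ring
  have k3 : γ * T * l * (α * √(L * Δ)) ≤ Δ / 100 := by
    calc γ * T * l * (α * √(L * Δ))
        ≤ 1 / 100 * (1 / (α * T * l) * √(Δ / L)) * T * l * (α * √(L * Δ)) := by gcongr
      _ = 1 / 100 * (√(Δ / L) * √(L * Δ)) := by field_simp
      _ = _ := by rw [hs]; ring
  have k4 : γ * T * l * (σ₁ * α ^ ((p - 1) / p)) ≤ Δ / 100 := by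
    have : 0 < α ^ ((p - 1) / p) := Real.rpow_pos_of_pos hα _
    calc γ * T * l * (σ₁ * α ^ ((p - 1) / p))
        ≤ 1 / 100 * (Δ / (σ₁ * α ^ ((p - 1) / p) * T * l)) * T * l *
          (σ₁ * α ^ ((p - 1) / p)) := by gcongr
      _ = _ := by field_simp
  -- As lam₁ is proportional to γ, this loss is quadratic in γ, hence the square root in the fifth
  -- term.
  have k5 : γ * T * l * threshold₁ q L α γ ≤ Δ / 5000 := by
    have hq' : 0 < α ^ (1 / q) := Real.rpow_pos_of_pos hα _
    have h := pow_le_pow_left₀ hγ.le g5 2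
    rw [mul_pow, Real.sq_sqrt (by positivity)] at h
    unfold threshold₁
    rw [Real.rpow_neg hα.le]
    calc γ * T * l * (2 * γ * L * (α ^ (1 / q))⁻¹)
        = γ ^ 2 * (2 * T * l * L * (α ^ (1 / q))⁻¹) := by ring
      _ ≤ (1 / 100) ^ 2 * (Δ * α ^ (1 / q) / (L * T * l)) *
          (2 * T * l * L * (α ^ (1 / q))⁻¹) := by gcongr
      _ = _ := by field_simp; norm_num
  have hth1 : 0 < threshold₁ q L α γ := by unfold threshold₁; positivity
  have hth2 : 0 < threshold₂ p L σ₁ Δ α := lt_max_of_lt_left (by positivity)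
  have k6 : γ * T * l * (α * threshold₂ p L σ₁ Δ α) ≤ Δ / 20 := by
    have := mul_le_mul_of_nonneg_left (mul_threshold₂_le (L := L) (Δ := Δ) hp hσ hα)
      (by positivity : 0 ≤ γ * T * l)
    linarith
  have hG2 : G ≤ 2 * √(L * Δ) := by
    refine abs_le_of_sq_le_sq' ?_ (by positivity) |>.2
    rw [mul_pow, Real.sq_sqrt (by positivity)]
    nlinarith [mul_pos hL hΔ]
  have k7 : γ * (G / α) ≤ Δ / 50 := by
    calc γ * (G / α) ≤ γ * (2 * √(L * Δ) / α) := by gcongr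
      _ = 2 * (γ * √(L * Δ) / α) := by ring
      _ ≤ _ := by linarith
  set u := threshold₁ q L α γ
  set v := α * threshold₂ p L σ₁ Δ α with hv
  have hv0 : 0 < v := by positivity
  have k8 : u + 2 * α * threshold₂ p L σ₁ Δ α + 6 * (u + v) * R ≤ 7 * (l * (u + v)) := by
    have h1 : 6 * (u + v) * R ≤ 6 * (u + v) * l := by gcongr
    have h2 : 2 * (u + v) ≤ l * (u + v) := by gcongr
    have h3 : 2 * α * threshold₂ p L σ₁ Δ α = 2 * v := by rw [hv]; ring
    linarith
  have k9 : γ * (T * (u + 2 * α * threshold₂ p L σ₁ Δ α + 6 * (u + v) * R)) ≤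
      7 * (γ * T * l * u + γ * T * l * v) := by
    calc _ ≤ γ * (T * (7 * (l * (u + v)))) := by gcongr
      _ = _ := by ring
  linarith

end Parameters

/-! ### Assembly of the high-probability bound. -/

/-- Lower-bounding the probability of an event by bounding a set that covers its complement. -/
theorem one_sub_le_measureReal {Ω : Type*} [MeasurableSpace Ω] {P : Measure Ω}
    [IsProbabilityMeasure P] {A B : Set Ω} {β : ℝ} (hB : P.real B ≤ β) (h : Bᶜ ⊆ A) :
    1 - β ≤ P.real A := by
  have h1 : P.real Set.univ ≤ P.real A + P.real B :=
    (measureReal_mono (fun ω _ => by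
      by_cases hω : ω ∈ B
      · exact Or.inr hω
      · exact Or.inl (h hω))).trans (measureReal_union_le A B)
  rw [probReal_univ] at h1
  linarith

/-- The 8 in the logarithm absorbs the additive 2 of the noise bound: 2 + log(T/β) ≤ log(8T/β). -/
theorem two_lt_log_eight : 2 < Real.log 8 := by
  rw [show (8 : ℝ) = 2 ^ 3 by norm_num, Real.log_pow]
  have := Real.log_two_gt_d9
  push_cast
  linarith

/-- With probability `1 - β`, a run with at most a hundredth of the stepsize scale as stepsize has
total gradient norm at most `2 Δ / γ`. -/
theorem one_sub_le_measureReal_sum_norm_gradient {d : ℕ} {Ξ : Type*} [MeasurableSpace Ξ]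
    {D : Measure Ξ} [IsProbabilityMeasure D] {Ω : Type*} [MeasurableSpace Ω] {P : Measure Ω}
    [IsProbabilityMeasure P] {F : Vec d → ℝ} {gradf : Vec d → Ξ → Vec d} {ξ : ℕ → Ω → Ξ}
    {x₀ : Vec d} {p q L σ₁ β α γ : ℝ} {T : ℕ} (hp : 1 < p) (hp2 : p ≤ 2) (hq : 1 ≤ q)
    (hq2 : q ≤ 2) (hL : 0 < L) (hσ : 0 < σ₁) (hF : Differentiable ℝ F)
    (hb : BddBelow (Set.range F)) (hm : Measurable (Function.uncurry gradf))
    (hB : BoundedCentralMoment D F gradf p σ₁) (hW : WeakAverageSmooth D gradf q L)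
    (hξ : ∀ t, Measurable (ξ t)) (hlaw : ∀ t, P.map (ξ t) = D) (hind : iIndepFun ξ P)
    (hT : 1 ≤ T) (hβ : 0 < β) (hβ1 : β ≤ 1) (hΔ : 0 < subopt F x₀) (hα0 : 0 < α) (hα1 : α ≤ 1)
    (hγ : 0 < γ) (hγM : γ ≤ 1 / 100 * stepScale p q L σ₁ (subopt F x₀) α T
      (Real.log (8 * T / β))) :
    1 - β ≤ P.real {ω | γ * ∑ t ∈ Finset.range T, ‖gradient F (iter gradf α
      (threshold₁ q L α γ) (threshold₂ p L σ₁ (subopt F x₀) α) γ x₀ 0 (fun t => ξ t ω) t)‖ ≤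
        2 * subopt F x₀} := by
  have hT0 : (0 : ℝ) < T := by exact_mod_cast hT
  have hTβ : 1 ≤ T / β := (one_le_div hβ).2 (hβ1.trans (by exact_mod_cast hT))
  have hlog : Real.log (8 * T / β) = Real.log 8 + Real.log (T / β) := by
    rw [mul_div_assoc, Real.log_mul (by norm_num) (by positivity)]
  have h8 := two_lt_log_eight
  have hlog0 := Real.log_nonneg hTβ
  set Δ := subopt F x₀ with hΔdef
  set lam₁ := threshold₁ q L α γ with hlam₁
  set lam₂ := threshold₂ p L σ₁ Δ α with hlam₂
  have h₁ : 0 < lam₁ := by rw [hlam₁]; unfold threshold₁; positivity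
  have h₂ : 0 < lam₂ := lt_max_of_lt_left (by positivity)
  have hs₁ := threshold₁_spec hq hL hγ hα0
  have hs₂ := threshold₂_spec (L := L) (Δ := Δ) hp hσ hα0
  have hlip := hB.lipschitz_gradient hW hq hL
  have hgsq := norm_gradient_sq_le hF hb hL hlip
  refine one_sub_le_measureReal (measureReal_noiseSum_le hB hW hm hp.le hp2 hq hq2 hL hα0.le hα1
    h₁ h₂ hs₁ hs₂ hξ hlaw hind x₀ 0 hT hβ) ?_
  intro ω hω
  simp only [Set.mem_compl_iff, Set.mem_iUnion, Finset.mem_range, Set.mem_ofPred_eq,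
    not_exists, not_le] at hω
  refine sum_norm_gradient_le hF hb hB hW hm hp.le hp2 hq hq2 hL hα0 hα1 h₁ h₂ hγ.le hs₁ hs₂ x₀
    (by positivity) _ ?_ (fun t ht => (hω t ht).le) ?_
  · intro x hx
    -- Suboptimality 2Δ gives ‖∇F‖² ≤ 4LΔ, and the 4 in the first candidate for lam₂ is twice the
    -- resulting 2.
    have h3 : ‖gradient F x‖ ≤ 2 * √(L * Δ) := by
      refine (abs_le_of_sq_le_sq' ?_ (by positivity)).2
      rw [mul_pow, Real.sq_sqrt (by positivity)]
      have := mul_le_mul_of_nonneg_left hx (by positivity : 0 ≤ 2 * L)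
      linarith [hgsq x]
    have h4 : 4 * √(L * Δ) ≤ lam₂ := le_max_left _ _
    linarith
  · exact budget_le hp hL hσ hΔ hα0 hT (by linarith) hγ hγM (hgsq x₀) (by linarith)

end DClipMVR

theorem mainTheorem10 :
    -- `c` is absolute and `C` depends on the ratio `κ` only
    ∃ c : ℝ, 0 < c ∧ ∀ κ : ℝ, 0 < κ → κ ≤ c → ∃ C : ℝ, 0 < C ∧
      ∀ {d : ℕ} {Ξ : Type*} [MeasurableSpace Ξ] (D : Measure Ξ) [IsProbabilityMeasure D]
        {Ω : Type*} [MeasurableSpace Ω] (P : Measure Ω) [IsProbabilityMeasure P]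
        (F : DClipMVR.Vec d → ℝ) (gradf : DClipMVR.Vec d → Ξ → DClipMVR.Vec d)
        (ξ : ℕ → Ω → Ξ) (x₀ : DClipMVR.Vec d) (p q L σ₁ β Δ α lam₁ lam₂ γ : ℝ) (T : ℕ),
        1 < p → p ≤ 2 → 1 ≤ q → q ≤ 2 → 0 < L → 0 < σ₁ →
        Differentiable ℝ F → BddBelow (Set.range F) →
        Measurable (Function.uncurry gradf) →
        DClipMVR.BoundedCentralMoment D F gradf p σ₁ →
        DClipMVR.WeakAverageSmooth D gradf q L →
        -- the samples are independent with law `D`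
        (∀ t, Measurable (ξ t)) → (∀ t, P.map (ξ t) = D) → iIndepFun ξ P →
        1 ≤ T → 0 < β → β ≤ 1 →
        Δ = DClipMVR.subopt F x₀ → 0 < Δ →
        α = DClipMVR.momentum p q T →
        lam₁ = DClipMVR.threshold₁ q L α γ →
        lam₂ = DClipMVR.threshold₂ p L σ₁ Δ α →
        κ * DClipMVR.stepScale p q L σ₁ Δ α T (Real.log (8 * T / β)) ≤ γ →
        γ ≤ c * DClipMVR.stepScale p q L σ₁ Δ α T (Real.log (8 * T / β)) →
        1 - β ≤ P.real {ω |
          DClipMVR.avgGradNorm F gradf α lam₁ lam₂ γ x₀ 0 (fun t => ξ t ω) T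
              ≤ 2 * Δ / (γ * T) ∧
          DClipMVR.avgGradNorm F gradf α lam₁ lam₂ γ x₀ 0 (fun t => ξ t ω) T
              ≤ C * (DClipMVR.rate p q L σ₁ Δ T * Real.log (8 * T / β)) ∧
          (2 ≤ T →
            DClipMVR.avgGradNorm F gradf α lam₁ lam₂ γ x₀ 0 (fun t => ξ t ω) T
              ≤ C * (DClipMVR.rate p q L σ₁ Δ T * Real.log (T / β)))} := by
  -- The value 1/100 is dictated by the budget. In 8/κ, a factor 2/κ comes from γ ≥ κM and a factor
  -- 4 from log(8T/β) ≤ 4 log(T/β) for T ≥ 2.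
  refine ⟨1 / 100, by norm_num, fun κ hκ _ => ⟨8 / κ, by positivity, ?_⟩⟩
  intro d Ξ _ D _ Ω _ P _ F gradf ξ x₀ p q L σ₁ β Δ α lam₁ lam₂ γ T hp hp2 hq hq2 hL hσ hF hb hm
    hB hW hξ hlaw hind hT hβ hβ1 hΔ hΔ0 hα hlam₁ hlam₂ hκγ hγM
  have hT0 : (0 : ℝ) < T := by exact_mod_cast hT
  have hlog : Real.log (8 * T / β) = Real.log 8 + Real.log (T / β) := by
    rw [mul_div_assoc, Real.log_mul (by norm_num) (by positivity)]
  have h8 := DClipMVR.two_lt_log_eight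
  have hlog0 : 0 ≤ Real.log (T / β) :=
    Real.log_nonneg ((one_le_div hβ).2 (hβ1.trans (by exact_mod_cast hT)))
  have hα0 : 0 < α := hα ▸ DClipMVR.momentum_pos hT
  have hα1 : α ≤ 1 := hα ▸ DClipMVR.momentum_le_one hp hq hT
  have hM := DClipMVR.stepScale_pos (p := p) (q := q) (l := Real.log (8 * T / β)) hL hσ hΔ0 hα0 hT
    (by linarith)
  have hγ : 0 < γ := (mul_pos hκ hM).trans_le hκγ
  have hrate := DClipMVR.le_stepScale_mul_rate (l := Real.log (8 * T / β)) hp hq hL hσ hΔ0 hT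
    (by linarith)
  rw [← hα] at hrate
  have hρ : 0 < DClipMVR.rate p q L σ₁ Δ T := by
    unfold DClipMVR.rate
    positivity
  set ρ := DClipMVR.rate p q L σ₁ Δ T
  set l := Real.log (8 * T / β) with hl
  have hl0 : 0 < l := by linarith
  have hbound : 2 * Δ / (γ * T) ≤ 2 / κ * (ρ * l) := by
    rw [div_le_iff₀ (by positivity)]
    calc 2 * Δ ≤ 2 * (DClipMVR.stepScale p q L σ₁ Δ α T l * (T * (ρ * l))) := by gcongr
      _ = 2 / κ * (κ * DClipMVR.stepScale p q L σ₁ Δ α T l) * (T * (ρ * l)) := by field_simp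
      _ ≤ 2 / κ * γ * (T * (ρ * l)) := by gcongr
      _ = _ := by ring
  have hprob := DClipMVR.one_sub_le_measureReal_sum_norm_gradient hp hp2 hq hq2 hL hσ hF hb hm hB
    hW hξ hlaw hind hT hβ hβ1 (hΔ ▸ hΔ0) hα0 hα1 hγ (hΔ ▸ hγM)
  rw [← hΔ, ← hlam₁, ← hlam₂] at hprob
  refine hprob.trans (measureReal_mono fun ω hω => ?_)
  have h1 : DClipMVR.avgGradNorm F gradf α lam₁ lam₂ γ x₀ 0 (fun t => ξ t ω) T ≤
      2 * Δ / (γ * T) := by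
    rw [le_div_iff₀ (by positivity)]
    unfold DClipMVR.avgGradNorm
    refine le_trans (le_of_eq ?_) hω
    field_simp
  have h2 := h1.trans hbound
  refine ⟨h1, h2.trans ?_, fun hT2 => h2.trans ?_⟩
  · gcongr
    norm_num
  · have h3 : Real.log 8 ≤ 3 * Real.log (T / β) := by
      rw [show (8 : ℝ) = 2 ^ 3 by norm_num, Real.log_pow]
      have h4 : Real.log 2 ≤ Real.log (T / β) := by
        refine Real.log_le_log two_pos ?_
        rw [le_div_iff₀ hβ]
        have : (2 : ℝ) ≤ T := by exact_mod_cast hT2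
        linarith
      push_cast
      linarith
    calc 2 / κ * (ρ * l) ≤ 2 / κ * (ρ * (4 * Real.log (T / β))) := by
          gcongr
          linarith
      _ = 8 / κ * (ρ * Real.log (T / β)) := by ring
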